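/- Let $G$ be a connected Lie group (real, finite-dimensional, smooth) with identity $e$ and Lie algebra $\mathfrak g = T_eG$, and let $F$ be a bi-invariant Finsler metric on $G$; that is, $F : TG \to [0,\infty)$ is continuous, smooth off the zero section, positively homogeneous of degree one on each tangent space, has positive definite fundamental form $g_y(u,v)=\tfrac12\frac{\partial^2}{\partial s\,\partial t}F^2(y+su+tv)\big|_{s=t=0}$ for every nonzero tangent vector $y$, and is invariant under the differentials of all left and right translations. A smooth curve $\sigma : J \to G$ on an interval $J\subseteq\mathbb R$ of positive length, with nowhere vanishing velocity $T=\dot\sigma$, is a constant speed geodesic if $F(T)$ is constant and $D_T\!\left[\frac{T}{F(T)}\right]=0$, where $D$ is the covariant derivative of the Chern connection of $F$ taken with reference vector $T$. A one-parameter subgroup is a smooth homomorphism $\gamma:\mathbb R\to G$; it is nontrivial if it is not constant. Then: 1. Every nonzero $X \in \mathfrak g$ is a geodesic vector, that is, $t \mapsto \exp(tX)$, $t\in\mathbb R$, is a constant speed geodesic. 2. If $0 \in J$ and $\sigma : J \to G$ is a curve with $\sigma(0)=e$, then $\sigma$ is a constant speed geodesic if and only if $\sigma$ is the restriction to $J$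 of a nontrivial one-parameter subgroup. 3. A curve $\sigma : J\to G$ is a constant speed geodesic if and only if there are $a \in G$ and a nontrivial one-parameter subgroup $\gamma$ with $\sigma(t) = a\,\gamma(t)$ for all $t \in J$; and also if and only if there are $a \in G$ and a nontrivial one-parameter subgroup $\gamma$ with $\sigma(t) = \gamma(t)\,a$ for all $t \in J$. -/

import Mathlib

open scoped Manifold ContDiff

noncomputable section

/-- The value at `y` of the fundamental form of a function `f` on a real vector space:
`g_y(u, v) = (1/2) ∂²/∂s∂t f(y + s u + t v)²` at `s = t = 0`. -/
def fundamentalForm {V : Type*} [AddCommGroup V] [Module ℝ V] (f : V → ℝ) (y u v : V) : ℝ :=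
  (1 / 2) * deriv (fun s : ℝ => deriv (fun t : ℝ => f (y + s • u + t • v) ^ 2) 0) 0

/-- A (positively homogeneous, not necessarily reversible) Finsler metric on an `n`-dimensional
smooth manifold `M`: a continuous nonnegative function on `TM`, smooth away from the zero section,
positively homogeneous of degree one, whose fundamental form `g_y` is positive definite for every
nonzero tangent vector `y`. -/
structure FinslerMetric (n : ℕ) (M : Type*) [TopologicalSpace M]
    [ChartedSpace (EuclideanSpace ℝ (Fin n)) M] [IsManifold (𝓡 n) ∞ M] where
  toFun : TangentBundle (𝓡 n) M → ℝ
  nonneg : ∀ v, 0 ≤ toFun v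
  continuous_toFun : Continuous toFun
  smooth_off_zero : ContMDiffOn (𝓡 n).tangent 𝓘(ℝ, ℝ) ∞ toFun {v | v.2 ≠ 0}
  homogeneous : ∀ (x : M) (u : TangentSpace (𝓡 n) x) (t : ℝ), 0 ≤ t →
    toFun ⟨x, t • u⟩ = t * toFun ⟨x, u⟩
  posDef : ∀ (x : M) (y u : TangentSpace (𝓡 n) x), y ≠ 0 → u ≠ 0 →
    0 < fundamentalForm (fun w : TangentSpace (𝓡 n) x => toFun ⟨x, w⟩) y u u

/-! ### Coordinate expressions

In a chart, functions on `TM` become functions `f x y` of the position `x` and the fibre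
coordinate `y`, both in `ℝⁿ`. -/

namespace FinslerCoord

variable {n : ℕ}

/-- The partial derivative `∂f/∂xᵏ`. -/
def pdx (k : Fin n) (f : EuclideanSpace ℝ (Fin n) → EuclideanSpace ℝ (Fin n) → ℝ)
    (x y : EuclideanSpace ℝ (Fin n)) : ℝ :=
  fderiv ℝ (fun x' => f x' y) x (EuclideanSpace.single k 1)

/-- The partial derivative `∂f/∂yᵏ`. -/
def pdy (k : Fin n) (f : EuclideanSpace ℝ (Fin n) → EuclideanSpace ℝ (Fin n) → ℝ)
    (x y : EuclideanSpace ℝ (Fin n)) : ℝ :=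
  fderiv ℝ (fun y' => f x y') y (EuclideanSpace.single k 1)

variable (f : EuclideanSpace ℝ (Fin n) → EuclideanSpace ℝ (Fin n) → ℝ)

/-- The fundamental tensor `g_ij(x, y) = (½ f²)_{yⁱ yʲ}`. -/
def g (i j : Fin n) (x y : EuclideanSpace ℝ (Fin n)) : ℝ :=
  (1 / 2) * pdy j (pdy i (fun x' y' => f x' y' ^ 2)) x y

/-- The entries `gⁱʲ(x, y)` of the inverse matrix of `(g_ij(x, y))`. -/
def gInv (i j : Fin n) (x y : EuclideanSpace ℝ (Fin n)) : ℝ :=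
  (Matrix.of fun a b : Fin n => g f a b x y)⁻¹ i j

/-- The formal Christoffel symbols of the second kind
`γⁱ_jk = ½ gⁱˡ (∂g_lj/∂xᵏ + ∂g_lk/∂xʲ - ∂g_jk/∂xˡ)`. -/
def formalChristoffel (i j k : Fin n) (x y : EuclideanSpace ℝ (Fin n)) : ℝ :=
  ∑ l, (1 / 2) * gInv f i l x y *
    (pdx k (g f l j) x y + pdx j (g f l k) x y - pdx l (g f j k) x y)

/-- The Cartan tensor `C_ijk = ½ ∂g_ij/∂yᵏ`. -/
def cartan (i j k : Fin n) (x y : EuclideanSpace ℝ (Fin n)) : ℝ :=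
  (1 / 2) * pdy k (g f i j) x y

/-- The nonlinear connection `Nⁱ_j = γⁱ_jk yᵏ - gⁱˡ C_ljk γᵏ_rs yʳ yˢ`. -/
def nonlinearConnection (i j : Fin n) (x y : EuclideanSpace ℝ (Fin n)) : ℝ :=
  ∑ k, formalChristoffel f i j k x y * y k -
    ∑ k, ∑ l, gInv f i l x y * cartan f l j k x y *
      ∑ r, ∑ s, formalChristoffel f k r s x y * y r * y s

/-- The horizontal derivative `δh/δxᵏ = ∂h/∂xᵏ - Nˢ_k ∂h/∂yˢ` determined by `f`. -/
def horizontalDeriv (k : Fin n)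
    (h : EuclideanSpace ℝ (Fin n) → EuclideanSpace ℝ (Fin n) → ℝ)
    (x y : EuclideanSpace ℝ (Fin n)) : ℝ :=
  pdx k h x y - ∑ s, nonlinearConnection f s k x y * pdy s h x y

/-- The coefficients of the Chern connection
`Γⁱ_jk = ½ gⁱˡ (δg_lj/δxᵏ + δg_lk/δxʲ - δg_jk/δxˡ)`. -/
def chernChristoffel (i j k : Fin n) (x y : EuclideanSpace ℝ (Fin n)) : ℝ :=
  ∑ l, (1 / 2) * gInv f i l x y *
    (horizontalDeriv f k (g f l j) x y + horizontalDeriv f j (g f l k) x y -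
      horizontalDeriv f l (g f j k) x y)

end FinslerCoord

/-! ### Curves, covariant derivatives along curves, geodesics -/

section Curves

variable {n : ℕ} {M : Type*} [TopologicalSpace M] [ChartedSpace (EuclideanSpace ℝ (Fin n)) M]

/-- The velocity at time `t` of a curve `σ` defined on the interval `J` (one-sided at those end
points of the interval that belong to it). -/
def curveVelocity (σ : ℝ → M) (J : Set ℝ) (t : ℝ) : TangentSpace (𝓡 n) (σ t) :=
  mfderivWithin 𝓘(ℝ, ℝ) (𝓡 n) σ J t (1 : ℝ)

/-- The coordinates of a tangent vector `v` at `p` in the chart `φ`. -/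
def chartCoord (φ : OpenPartialHomeomorph M (EuclideanSpace ℝ (Fin n))) (p : M)
    (v : TangentSpace (𝓡 n) p) : EuclideanSpace ℝ (Fin n) :=
  mfderiv (𝓡 n) (𝓡 n) φ p v

namespace FinslerMetric

variable [IsManifold (𝓡 n) ∞ M] (F : FinslerMetric n M)

/-- The expression `F(x, y)` of the metric in the chart `φ`. -/
def inChart (φ : OpenPartialHomeomorph M (EuclideanSpace ℝ (Fin n)))
    (x y : EuclideanSpace ℝ (Fin n)) : ℝ :=
  F.toFun ⟨φ.symm x, mfderiv (𝓡 n) (𝓡 n) φ.symm x y⟩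

/-- The `i`-th component, in the chart `φ` and at time `t`, of the covariant derivative `D_T U` with
reference vector `W`, for vector fields `U`, `W` along `σ : J → M` with velocity `T`:
`dUⁱ/dt + Uʲ Tᵏ Γⁱ_jk(σ, W)`. -/
def covDerivAlong (φ : OpenPartialHomeomorph M (EuclideanSpace ℝ (Fin n))) (σ : ℝ → M) (J : Set ℝ)
    (U W : ∀ t : ℝ, TangentSpace (𝓡 n) (σ t)) (t : ℝ) (i : Fin n) : ℝ :=
  derivWithin (fun s => chartCoord φ (σ s) (U s) i) J t +
    ∑ j, ∑ k, chartCoord φ (σ t) (U t) j * chartCoord φ (σ t) (curveVelocity σ J t) k *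
      FinslerCoord.chernChristoffel (F.inChart φ) i j k (φ (σ t)) (chartCoord φ (σ t) (W t))

/-- A smooth regular curve `σ : J → M` with velocity `T` is a geodesic of `F` if
`D_T [T / F(T)] = 0` with reference vector `T` (in every chart of the smooth structure). -/
def IsGeodesicOn (σ : ℝ → M) (J : Set ℝ) : Prop :=
  ContMDiffOn 𝓘(ℝ, ℝ) (𝓡 n) ∞ σ J ∧
  (∀ t ∈ J, curveVelocity (n := n) σ J t ≠ 0) ∧
  ∀ φ ∈ IsManifold.maximalAtlas (𝓡 n) ∞ M, ∀ t ∈ J, σ t ∈ φ.source → ∀ i : Fin n,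
    F.covDerivAlong φ σ J
      (fun s => (F.toFun ⟨σ s, curveVelocity σ J s⟩)⁻¹ • curveVelocity σ J s)
      (fun s => curveVelocity σ J s) t i = 0

/-- A geodesic `σ : J → M` parameterized to have constant Finslerian speed `F(T)`. -/
def IsConstSpeedGeodesicOn (σ : ℝ → M) (J : Set ℝ) : Prop :=
  F.IsGeodesicOn σ J ∧
  ∀ s ∈ J, ∀ t ∈ J,
    F.toFun ⟨σ s, curveVelocity σ J s⟩ = F.toFun ⟨σ t, curveVelocity σ J t⟩

end FinslerMetric

end Curves

/-! ### Lie groups -/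

section LieGroups

variable {n : ℕ} {G : Type*} [TopologicalSpace G] [ChartedSpace (EuclideanSpace ℝ (Fin n)) G]
  [Group G]

variable (n) in
/-- A one-parameter subgroup: a smooth homomorphism from `(ℝ, +)` to `G`. -/
def IsOneParameterSubgroup (γ : ℝ → G) : Prop :=
  ContMDiff 𝓘(ℝ, ℝ) (𝓡 n) ∞ γ ∧ ∀ s t : ℝ, γ (s + t) = γ s * γ t

open Classical in
/-- The exponential map of a Lie group: `exp X = γ(1)` for the one-parameter subgroup `γ` with
`γ(0) = e` and `γ'(0) = X` (which exists and is unique). -/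
def lieExp (X : GroupLieAlgebra (𝓡 n) G) : G :=
  if h : ∃ γ : ℝ → G, IsOneParameterSubgroup n γ ∧
      (⟨γ 0, mfderiv 𝓘(ℝ, ℝ) (𝓡 n) γ 0 (1 : ℝ)⟩ : TangentBundle (𝓡 n) G) = ⟨1, X⟩
  then h.choose 1 else 1

namespace FinslerMetric

variable [IsManifold (𝓡 n) ∞ G] (F : FinslerMetric n G)

/-- `F` is invariant under the differentials of all left and all right translations. -/
def IsBiInvariant : Prop :=
  ∀ (a : G) (v : TangentBundle (𝓡 n) G),
    F.toFun (tangentMap (𝓡 n) (𝓡 n) (fun x => a * x) v) = F.toFun v ∧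
    F.toFun (tangentMap (𝓡 n) (𝓡 n) (fun x => x * a) v) = F.toFun v

/-- A nonzero vector `X` of the Lie algebra is a geodesic vector if `t ↦ exp(tX)`, `t ∈ ℝ`, is a
constant speed geodesic. -/
def IsGeodesicVector (X : GroupLieAlgebra (𝓡 n) G) : Prop :=
  X ≠ 0 ∧ F.IsConstSpeedGeodesicOn (fun t : ℝ => lieExp (t • X)) Set.univ

end FinslerMetric

end LieGroups

end

/-! The theorem is an instance of Noether's principle. Write E = F²/2 and p_l = ∂E/∂yˡ. Contracted
twice with the reference vector, the Chern coefficients lose their nonlinear-connection terms,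
because the Cartan tensor annihilates y. What remains is the spray of E, so for curves of constant
speed the geodesic equation is the Euler–Lagrange equation of E
(`IsFinslerOn.geodesic_iff_euler_lagrange`).

The flow of a left-invariant field consists of right translations. Right invariance of F therefore
makes every left-invariant field Killing (`fderiv_energy_frame`), and its pairing with the momentum
is conserved along geodesics. Left invariance computes this pairing: if ξ in the Lie algebra is the
left trivialization of the velocity, the pairing with the field of Z is dE₀(ξ)Z, where E₀ is the
energy on the Lie algebra. Differentiating along an arbitrary curve shows that the Euler–Lagrange
defect paired with the field of Z equals g_ξ(ξ', Z) (`sum_euler_lagrange_frame`). As g_ξ is positive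
definite and the left-invariant fields span, the defect vanishes exactly when ξ' = 0
(`geodesic_iff_derivWithin_eq_zero`).

Hence constant speed geodesics are the integral curves of nonzero left-invariant fields. Uniqueness
of integral curves makes these the left translates of nontrivial one-parameter subgroups
(`exists_curveVelocity_eq_iff`), and conjugation by the translating element exchanges left and right
translates. -/

/-! ### Calculus of homogeneous functions -/

section Calculus

variable {V : Type*} [NormedAddCommGroup V] [NormedSpace ℝ V]

/-- Euler's identity for positively homogeneous functions. -/
theorem fderiv_self_of_homogeneous {h : V → ℝ} {y : V} {k : ℕ} (hd : DifferentiableAt ℝ h y)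
    (hom : ∀ t : ℝ, 0 < t → h (t • y) = t ^ k * h y) : fderiv ℝ h y y = k * h y := by
  have h1 : HasDerivAt (fun t : ℝ => h (t • y)) (fderiv ℝ h y y) 1 := by
    have hl : HasDerivAt (fun t : ℝ => t • y) y 1 := by
      simpa using (hasDerivAt_id (1 : ℝ)).smul_const y
    have hd' : HasFDerivAt h (fderiv ℝ h y) ((1 : ℝ) • y) := by
      rw [one_smul]; exact hd.hasFDerivAt
    exact hd'.comp_hasDerivAt (1 : ℝ) hl
  have h2 : HasDerivAt (fun t : ℝ => t ^ k * h y) (k * h y) 1 := by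
    simpa using (hasDerivAt_pow k (1 : ℝ)).mul_const (h y)
  refine h1.unique (h2.congr_of_eventuallyEq ?_)
  filter_upwards [lt_mem_nhds (zero_lt_one' ℝ)] with t ht using hom t ht

/-- The fundamental form is the second derivative of the energy `f² / 2`. -/
theorem fundamentalForm_eq_fderiv {h : V → ℝ} {y : V} (hd : ContDiffAt ℝ 2 h y) (u v : V) :
    fundamentalForm h y u v =
      fderiv ℝ (fun w => fderiv ℝ (fun w' => (1 / 2) * h w' ^ 2) w v) y u := by
  set e : V → ℝ := fun w' => (1 / 2) * h w' ^ 2 with he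
  have hec : ContDiffAt ℝ 2 e y := contDiffAt_const.mul (hd.pow 2)
  have hev : ∀ᶠ w in nhds y, DifferentiableAt ℝ e w := by
    filter_upwards [(hec.of_le one_le_two).eventually (by simp)] with w hw
      using hw.differentiableAt (by simp)
  have hcont : Filter.Tendsto (fun s : ℝ => y + s • u) (nhds 0) (nhds y) := by
    have : Continuous fun s : ℝ => y + s • u := by fun_prop
    simpa using this.tendsto 0
  -- The factor 2 is h² = 2e; it cancels the 1/2 in `fundamentalForm`.
  have inner_eq : (fun s : ℝ => deriv (fun t : ℝ => h (y + s • u + t • v) ^ 2) 0)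
      =ᶠ[nhds 0] fun s => 2 * fderiv ℝ e (y + s • u) v := by
    filter_upwards [hcont.eventually hev] with s hs
    have hl : HasDerivAt (fun t : ℝ => y + s • u + t • v) v 0 := by
      simpa using ((hasDerivAt_id (0 : ℝ)).smul_const v).const_add (y + s • u)
    have hs' : HasFDerivAt e (fderiv ℝ e (y + s • u)) (y + s • u + (0 : ℝ) • v) := by
      simpa using hs.hasFDerivAt
    have := (hs'.comp_hasDerivAt (0 : ℝ) hl).const_mul 2
    refine Eq.trans (congrArg (fun F => deriv F 0) ?_) this.deriv
    funext t
    simp [he]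
  have hD : HasFDerivAt (fun w => fderiv ℝ e w v)
      (fderiv ℝ (fun w => fderiv ℝ e w v) y) (y + (0 : ℝ) • u) := by
    have : DifferentiableAt ℝ (fun w => fderiv ℝ e w v) y :=
      ((hec.fderiv_right (m := 1) (by norm_num)).differentiableAt (by simp)).clm_apply
        (differentiableAt_const v)
    simpa using this.hasFDerivAt
  have hl : HasDerivAt (fun s : ℝ => y + s • u) u 0 := by
    simpa using ((hasDerivAt_id (0 : ℝ)).smul_const u).const_add y
  have hmain : HasDerivAt (fun s : ℝ => 2 * fderiv ℝ e (y + s • u) v)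
      (2 * fderiv ℝ (fun w => fderiv ℝ e w v) y u) 0 :=
    (hD.comp_hasDerivAt (0 : ℝ) hl).const_mul 2
  rw [fundamentalForm, inner_eq.deriv_eq, hmain.deriv]
  ring

end Calculus

/-! ### Partial derivatives of functions of position and direction -/

namespace FinslerCoord

variable {n : ℕ}

/-- `h x y` is smooth for `x ∈ U` and `y ≠ 0`. -/
def SmoothOff (U : Set (EuclideanSpace ℝ (Fin n)))
    (h : EuclideanSpace ℝ (Fin n) → EuclideanSpace ℝ (Fin n) → ℝ) : Prop :=
  ContDiffOn ℝ ∞ (fun p : EuclideanSpace ℝ (Fin n) × EuclideanSpace ℝ (Fin n) => h p.1 p.2)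
    (U ×ˢ {0}ᶜ)

section Partial

variable {U : Set (EuclideanSpace ℝ (Fin n))}
  {h : EuclideanSpace ℝ (Fin n) → EuclideanSpace ℝ (Fin n) → ℝ}
  {x y : EuclideanSpace ℝ (Fin n)}

theorem SmoothOff.contDiffAt (hh : SmoothOff U h) (hU : IsOpen U) (hx : x ∈ U) (hy : y ≠ 0) :
    ContDiffAt ℝ ∞
      (fun p : EuclideanSpace ℝ (Fin n) × EuclideanSpace ℝ (Fin n) => h p.1 p.2) (x, y) :=
  ContDiffOn.contDiffAt hh ((hU.prod isOpen_compl_singleton).mem_nhds ⟨hx, hy⟩)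

theorem SmoothOff.hasFDerivAt (hh : SmoothOff U h) (hU : IsOpen U) (hx : x ∈ U) (hy : y ≠ 0) :
    HasFDerivAt (fun p : EuclideanSpace ℝ (Fin n) × EuclideanSpace ℝ (Fin n) => h p.1 p.2)
      (fderiv ℝ (fun p : EuclideanSpace ℝ (Fin n) × EuclideanSpace ℝ (Fin n) => h p.1 p.2) (x, y))
      (x, y) :=
  ((hh.contDiffAt hU hx hy).differentiableAt (by simp)).hasFDerivAt

theorem SmoothOff.hasFDerivAt_left (hh : SmoothOff U h) (hU : IsOpen U) (hx : x ∈ U)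
    (hy : y ≠ 0) : HasFDerivAt (fun x' => h x' y)
      ((fderiv ℝ (fun p : EuclideanSpace ℝ (Fin n) × EuclideanSpace ℝ (Fin n) => h p.1 p.2)
        (x, y)).comp (ContinuousLinearMap.inl ℝ _ _)) x :=
  HasFDerivAt.comp (f := fun x' => (x', y)) x (hh.hasFDerivAt hU hx hy)
    (hasFDerivAt_prodMk_left x y)

theorem SmoothOff.hasFDerivAt_right (hh : SmoothOff U h) (hU : IsOpen U) (hx : x ∈ U)
    (hy : y ≠ 0) : HasFDerivAt (fun y' => h x y')
      ((fderiv ℝ (fun p : EuclideanSpace ℝ (Fin n) × EuclideanSpace ℝ (Fin n) => h p.1 p.2)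
        (x, y)).comp (ContinuousLinearMap.inr ℝ _ _)) y :=
  HasFDerivAt.comp (f := fun y' => (x, y')) y (hh.hasFDerivAt hU hx hy)
    (hasFDerivAt_prodMk_right x y)

theorem SmoothOff.pdx_eq (hh : SmoothOff U h) (hU : IsOpen U) (hx : x ∈ U) (hy : y ≠ 0)
    (k : Fin n) : pdx k h x y =
      fderiv ℝ (fun p : EuclideanSpace ℝ (Fin n) × EuclideanSpace ℝ (Fin n) => h p.1 p.2) (x, y)
        (EuclideanSpace.single k 1, 0) := by
  rw [pdx, (hh.hasFDerivAt_left hU hx hy).fderiv]; simp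

theorem SmoothOff.pdy_eq (hh : SmoothOff U h) (hU : IsOpen U) (hx : x ∈ U) (hy : y ≠ 0)
    (k : Fin n) : pdy k h x y =
      fderiv ℝ (fun p : EuclideanSpace ℝ (Fin n) × EuclideanSpace ℝ (Fin n) => h p.1 p.2) (x, y)
        (0, EuclideanSpace.single k 1) := by
  rw [pdy, (hh.hasFDerivAt_right hU hx hy).fderiv]; simp

theorem SmoothOff.fderiv_apply (hh : SmoothOff U h) (hU : IsOpen U)
    (w : EuclideanSpace ℝ (Fin n) × EuclideanSpace ℝ (Fin n)) :
    SmoothOff U (fun x y => fderiv ℝ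
      (fun p : EuclideanSpace ℝ (Fin n) × EuclideanSpace ℝ (Fin n) => h p.1 p.2) (x, y) w) :=
  (ContDiffOn.fderiv_of_isOpen (m := ∞) hh (hU.prod isOpen_compl_singleton) (by simp)).clm_apply
    contDiffOn_const

theorem SmoothOff.pdy (hh : SmoothOff U h) (hU : IsOpen U) (k : Fin n) :
    SmoothOff U (pdy k h) :=
  (hh.fderiv_apply hU (0, EuclideanSpace.single k 1)).congr
    fun _ hp => hh.pdy_eq hU hp.1 hp.2 k

theorem SmoothOff.differentiableAt_left (hh : SmoothOff U h) (hU : IsOpen U) (hx : x ∈ U)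
    (hy : y ≠ 0) : DifferentiableAt ℝ (fun x' => h x' y) x :=
  (hh.hasFDerivAt_left hU hx hy).differentiableAt

theorem SmoothOff.differentiableAt_right (hh : SmoothOff U h) (hU : IsOpen U) (hx : x ∈ U)
    (hy : y ≠ 0) : DifferentiableAt ℝ (fun y' => h x y') y :=
  (hh.hasFDerivAt_right hU hx hy).differentiableAt

/-- A vector is the sum of its components along the standard basis. -/
theorem sum_smul_single (v : EuclideanSpace ℝ (Fin n)) :
    v = ∑ k, v k • EuclideanSpace.single k (1 : ℝ) := by
  ext i
  simp [Pi.single_apply]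

theorem clm_apply_eq_sum {W : Type*} [NormedAddCommGroup W] [NormedSpace ℝ W]
    (T : EuclideanSpace ℝ (Fin n) →L[ℝ] W) (v : EuclideanSpace ℝ (Fin n)) :
    T v = ∑ k, v k • T (EuclideanSpace.single k 1) := by
  conv_lhs => rw [sum_smul_single v]
  simp

theorem SmoothOff.fderiv_eq_sum (hh : SmoothOff U h) (hU : IsOpen U) (hx : x ∈ U)
    (hy : y ≠ 0) (u v : EuclideanSpace ℝ (Fin n)) :
    fderiv ℝ (fun p : EuclideanSpace ℝ (Fin n) × EuclideanSpace ℝ (Fin n) => h p.1 p.2) (x, y)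
      (u, v) = ∑ k, u k * pdx k h x y + ∑ k, v k * FinslerCoord.pdy k h x y := by
  set T := fderiv ℝ
    (fun p : EuclideanSpace ℝ (Fin n) × EuclideanSpace ℝ (Fin n) => h p.1 p.2) (x, y) with hT
  have h1 : T (u, v) = T.comp (ContinuousLinearMap.inl ℝ _ _) u +
      T.comp (ContinuousLinearMap.inr ℝ _ _) v := by
    simp [← map_add]
  rw [h1, clm_apply_eq_sum _ u, clm_apply_eq_sum _ v]
  simp [hh.pdx_eq hU hx hy, hh.pdy_eq hU hx hy, hT]

theorem pdy_congr {h' : EuclideanSpace ℝ (Fin n) → EuclideanSpace ℝ (Fin n) → ℝ} (hy : y ≠ 0)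
    (heq : ∀ y' ≠ 0, h x y' = h' x y') (k : Fin n) : pdy k h x y = pdy k h' x y := by
  have : (fun y' => h x y') =ᶠ[nhds y] fun y' => h' x y' := by
    filter_upwards [isOpen_ne.mem_nhds hy] with y' hy' using heq y' hy'
  rw [FinslerCoord.pdy, this.fderiv_eq, FinslerCoord.pdy]

theorem pdx_congr {h' : EuclideanSpace ℝ (Fin n) → EuclideanSpace ℝ (Fin n) → ℝ} (hU : IsOpen U)
    (hx : x ∈ U) (heq : ∀ x' ∈ U, h x' y = h' x' y) (k : Fin n) : pdx k h x y = pdx k h' x y := by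
  have : (fun x' => h x' y) =ᶠ[nhds x] fun x' => h' x' y := by
    filter_upwards [hU.mem_nhds hx] with x' hx' using heq x' hx'
  rw [FinslerCoord.pdx, this.fderiv_eq, FinslerCoord.pdx]

theorem pdx_sum {ι : Type*} [Fintype ι] (c : ι → ℝ)
    {H : ι → EuclideanSpace ℝ (Fin n) → EuclideanSpace ℝ (Fin n) → ℝ}
    (hH : ∀ i, DifferentiableAt ℝ (fun x' => H i x' y) x) (k : Fin n) :
    pdx k (fun x' y' => ∑ i, c i * H i x' y') x y = ∑ i, c i * pdx k (H i) x y := by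
  simp only [pdx]
  have : HasFDerivAt (fun x' => ∑ i, c i * H i x' y)
      (∑ i, c i • fderiv ℝ (fun x' => H i x' y) x) x :=
    HasFDerivAt.fun_sum fun i _ => (hH i).hasFDerivAt.const_mul (c i)
  rw [this.fderiv]
  simp

end Partial

/-! ### The Chern geodesic equation as an Euler–Lagrange equation -/

/-- The energy `f² / 2`. -/
noncomputable def energy (f : EuclideanSpace ℝ (Fin n) → EuclideanSpace ℝ (Fin n) → ℝ)
    (x y : EuclideanSpace ℝ (Fin n)) : ℝ :=
  (1 / 2) * f x y ^ 2

/-- The momentum `p_l = ∂(f² / 2)/∂yˡ`. -/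
noncomputable def momentum (f : EuclideanSpace ℝ (Fin n) → EuclideanSpace ℝ (Fin n) → ℝ)
    (l : Fin n) : EuclideanSpace ℝ (Fin n) → EuclideanSpace ℝ (Fin n) → ℝ :=
  pdy l (energy f)

/-- `f` is the coordinate expression of a Finsler metric over the open set `U`. -/
structure IsFinslerOn (f : EuclideanSpace ℝ (Fin n) → EuclideanSpace ℝ (Fin n) → ℝ)
    (U : Set (EuclideanSpace ℝ (Fin n))) : Prop where
  isOpen : IsOpen U
  smooth : SmoothOff U f
  homogeneous : ∀ x ∈ U, ∀ (y : EuclideanSpace ℝ (Fin n)) (t : ℝ), 0 ≤ t →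
    f x (t • y) = t * f x y
  posDef : ∀ x ∈ U, ∀ y u : EuclideanSpace ℝ (Fin n), y ≠ 0 → u ≠ 0 →
    0 < fundamentalForm (f x) y u u

namespace IsFinslerOn

variable {f : EuclideanSpace ℝ (Fin n) → EuclideanSpace ℝ (Fin n) → ℝ}
  {U : Set (EuclideanSpace ℝ (Fin n))} {x y : EuclideanSpace ℝ (Fin n)}

theorem smooth_energy (hf : IsFinslerOn f U) : SmoothOff U (energy f) :=
  contDiffOn_const.mul (ContDiffOn.pow hf.smooth 2)

theorem smooth_momentum (hf : IsFinslerOn f U) (l : Fin n) : SmoothOff U (momentum f l) :=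
  hf.smooth_energy.pdy hf.isOpen l

theorem g_eq (hf : IsFinslerOn f U) (hx : x ∈ U) (hy : y ≠ 0) (i j : Fin n) :
    g f i j x y = pdy j (momentum f i) x y := by
  have h1 : ∀ y' ≠ 0, pdy i (fun x' y' => f x' y' ^ 2) x y' = 2 * momentum f i x y' := by
    intro y' hy'
    have hd := hf.smooth_energy.differentiableAt_right hf.isOpen hx hy'
    have : (fun y' => f x y' ^ 2) = fun y' => (2 : ℝ) * energy f x y' := by
      funext y'; simp [energy]
    rw [pdy, this, fderiv_const_mul hd]
    simp [momentum, pdy]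
  rw [g, pdy_congr (h' := fun x' y' => 2 * momentum f i x' y') hy h1, pdy,
    fderiv_const_mul ((hf.smooth_momentum i).differentiableAt_right hf.isOpen hx hy)]
  simp [pdy]

theorem smooth_g (hf : IsFinslerOn f U) (i j : Fin n) : SmoothOff U (g f i j) :=
  ((hf.smooth_momentum i).pdy hf.isOpen j).congr fun _ hp => hf.g_eq hp.1 hp.2 i j

/-- `p_j yʲ = f²`. -/
theorem sum_momentum (hf : IsFinslerOn f U) (hx : x ∈ U) (hy : y ≠ 0) :
    ∑ j, y j * momentum f j x y = 2 * energy f x y := by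
  have := fderiv_self_of_homogeneous (k := 2)
    (hf.smooth_energy.differentiableAt_right hf.isOpen hx hy) (fun t ht => by
      simp only [energy, hf.homogeneous x hx y t ht.le]; ring)
  rw [clm_apply_eq_sum] at this
  simpa [momentum, pdy] using this

/-- The energy is homogeneous of degree two, so its fibre derivative has degree one: differentiate
E(x, t y) = t² E(x, y) in y and cancel one t. -/
theorem momentum_smul (hf : IsFinslerOn f U) (hx : x ∈ U) (hy : y ≠ 0) (l : Fin n) {t : ℝ}
    (ht : 0 < t) : momentum f l x (t • y) = t * momentum f l x y := by
  have hty : t • y ≠ 0 := smul_ne_zero ht.ne' hy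
  have h1 : HasFDerivAt (fun y' => energy f x (t • y'))
      (t • fderiv ℝ (fun y' => energy f x y') (t • y)) y := by
    have hd := (hf.smooth_energy.differentiableAt_right hf.isOpen hx hty).hasFDerivAt
    have := hd.comp y ((hasFDerivAt_id y).const_smul t)
    refine this.congr_fderiv ?_
    ext v; simp
  have h2 : HasFDerivAt (fun y' => energy f x (t • y'))
      (t ^ 2 • fderiv ℝ (fun y' => energy f x y') y) y := by
    have hd := (hf.smooth_energy.differentiableAt_right hf.isOpen hx hy).hasFDerivAt
    refine (hd.const_mul (t ^ 2)).congr_of_eventuallyEq (Filter.Eventually.of_forall fun y' => ?_)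
    simp only [energy, hf.homogeneous x hx y' t ht.le]; ring
  have := congrArg (fun T => T (EuclideanSpace.single l (1 : ℝ))) (h1.unique h2)
  simp only [smul_apply, smul_eq_mul] at this
  simp only [momentum, pdy]
  exact mul_left_cancel₀ ht.ne' (by linarith)

/-- `g_lj yʲ = p_l`. -/
theorem sum_g (hf : IsFinslerOn f U) (hx : x ∈ U) (hy : y ≠ 0) (l : Fin n) :
    ∑ j, y j * g f l j x y = momentum f l x y := by
  have := fderiv_self_of_homogeneous (k := 1)
    ((hf.smooth_momentum l).differentiableAt_right hf.isOpen hx hy) (fun t ht => by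
      simpa using hf.momentum_smul hx hy l ht)
  rw [clm_apply_eq_sum] at this
  simpa [hf.g_eq hx hy, pdy] using this

/-- The identity g_lj yʲ = p_l is differentiated in x with y frozen. -/
theorem sum_pdx_g (hf : IsFinslerOn f U) (hx : x ∈ U) (hy : y ≠ 0) (k l : Fin n) :
    ∑ j, y j * pdx k (g f l j) x y = pdx k (momentum f l) x y := by
  rw [← pdx_sum (fun j => y j)
    fun j => (hf.smooth_g l j).differentiableAt_left hf.isOpen hx hy]
  exact pdx_congr hf.isOpen hx (fun x' hx' => hf.sum_g hx' hy l) k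

/-- The Cartan tensor annihilates `y`. -/
theorem sum_pdy_g (hf : IsFinslerOn f U) (hx : x ∈ U) (hy : y ≠ 0) (s l : Fin n) :
    ∑ j, y j * pdy s (g f l j) x y = 0 := by
  have h1 : HasFDerivAt (fun y' : EuclideanSpace ℝ (Fin n) => ∑ j, y' j * g f l j x y')
      (∑ j, (y j • fderiv ℝ (fun y' => g f l j x y') y +
        g f l j x y • (EuclideanSpace.proj j : EuclideanSpace ℝ (Fin n) →L[ℝ] ℝ))) y :=
    HasFDerivAt.fun_sum fun j _ =>
      (EuclideanSpace.proj j : EuclideanSpace ℝ (Fin n) →L[ℝ] ℝ).hasFDerivAt.mul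
        ((hf.smooth_g l j).differentiableAt_right hf.isOpen hx hy).hasFDerivAt
  -- The sum is p_l, whose derivative in yˢ is g_ls. The product rule yields another g_ls from
  -- differentiating the factor yʲ, and cancelling the two leaves the Cartan term equal to zero.
  have h2 : pdy s (fun x' y' => ∑ j, y' j * g f l j x' y') x y = g f l s x y := by
    rw [hf.g_eq hx hy]
    exact pdy_congr hy (fun y' hy' => hf.sum_g hx hy' l) s
  rw [pdy, h1.fderiv] at h2
  simp only [sum_apply, add_apply,
    smul_apply, smul_eq_mul, Finset.sum_add_distrib] at h2
  have h3 : ∑ j, g f l j x y * (EuclideanSpace.proj j : EuclideanSpace ℝ (Fin n) →L[ℝ] ℝ)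
      (EuclideanSpace.single s (1 : ℝ)) = g f l s x y := by
    simp
  rw [h3] at h2
  simpa [pdy] using h2

/-- The nonlinear connection enters only through yʲ ∂g_lj/∂yˢ, which vanishes by `sum_pdy_g`. Its
explicit formula therefore never matters for geodesics. -/
theorem sum_horizontalDeriv_g (hf : IsFinslerOn f U) (hx : x ∈ U) (hy : y ≠ 0) (k l : Fin n) :
    ∑ j, y j * horizontalDeriv f k (g f l j) x y = pdx k (momentum f l) x y := by
  simp only [horizontalDeriv, mul_sub, Finset.sum_sub_distrib, hf.sum_pdx_g hx hy,
    Finset.mul_sum]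
  rw [Finset.sum_comm, sub_eq_self]
  refine Finset.sum_eq_zero fun s _ => ?_
  rw [← mul_zero (nonlinearConnection f s k x y), ← hf.sum_pdy_g hx hy s l, Finset.mul_sum]
  exact Finset.sum_congr rfl fun j _ => by ring

/-- A second contraction with y uses p_j yʲ = 2E, differentiated in x. -/
theorem sum_sum_horizontalDeriv_g (hf : IsFinslerOn f U) (hx : x ∈ U) (hy : y ≠ 0) (l : Fin n) :
    ∑ j, ∑ k, y j * y k * horizontalDeriv f l (g f j k) x y = 2 * pdx l (energy f) x y := by
  simp only [mul_assoc, ← Finset.mul_sum, hf.sum_horizontalDeriv_g hx hy]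
  rw [← pdx_sum (fun j => y j)
    fun j => (hf.smooth_momentum j).differentiableAt_left hf.isOpen hx hy,
    pdx_congr (h' := fun x' y' => 2 * energy f x' y') hf.isOpen hx
      (fun x' hx' => hf.sum_momentum hx' hy), pdx,
    fderiv_const_mul (hf.smooth_energy.differentiableAt_left hf.isOpen hx hy)]
  simp [pdx]

/-- The spray coefficients of the Chern connection. -/
theorem sum_chernChristoffel (hf : IsFinslerOn f U) (hx : x ∈ U) (hy : y ≠ 0) (i : Fin n) :
    ∑ j, ∑ k, y j * y k * chernChristoffel f i j k x y =
      ∑ l, gInv f i l x y *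
        (∑ k, y k * pdx k (momentum f l) x y - pdx l (energy f) x y) := by
  have h1 : ∀ l, ∑ j, ∑ k, y j * y k * horizontalDeriv f k (g f l j) x y =
      ∑ k, y k * pdx k (momentum f l) x y := by
    intro l
    rw [Finset.sum_comm]
    refine Finset.sum_congr rfl fun k _ => ?_
    rw [← hf.sum_horizontalDeriv_g hx hy, Finset.mul_sum]
    exact Finset.sum_congr rfl fun j _ => by ring
  have h2 : ∀ l, ∑ j, ∑ k, y j * y k * horizontalDeriv f j (g f l k) x y =
      ∑ k, y k * pdx k (momentum f l) x y := by
    intro l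
    refine Finset.sum_congr rfl fun j _ => ?_
    rw [← hf.sum_horizontalDeriv_g hx hy, Finset.mul_sum]
    exact Finset.sum_congr rfl fun k _ => by ring
  calc ∑ j, ∑ k, y j * y k * chernChristoffel f i j k x y
      = ∑ j, ∑ k, ∑ l, (1 / 2) * gInv f i l x y *
          (y j * y k * horizontalDeriv f k (g f l j) x y +
            y j * y k * horizontalDeriv f j (g f l k) x y -
            y j * y k * horizontalDeriv f l (g f j k) x y) := by
        refine Finset.sum_congr rfl fun j _ => Finset.sum_congr rfl fun k _ => ?_
        rw [chernChristoffel, Finset.mul_sum]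
        exact Finset.sum_congr rfl fun l _ => by ring
    _ = ∑ l, (1 / 2) * gInv f i l x y *
          (∑ j, ∑ k, y j * y k * horizontalDeriv f k (g f l j) x y +
            ∑ j, ∑ k, y j * y k * horizontalDeriv f j (g f l k) x y -
            ∑ j, ∑ k, y j * y k * horizontalDeriv f l (g f j k) x y) := by
        simp only [← Finset.sum_add_distrib, ← Finset.sum_sub_distrib, Finset.mul_sum]
        rw [Finset.sum_congr rfl fun j _ => Finset.sum_comm, Finset.sum_comm]
    _ = _ := by
        refine Finset.sum_congr rfl fun l _ => ?_
        rw [h1, h2, hf.sum_sum_horizontalDeriv_g hx hy]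
        ring

theorem fundamentalForm_eq_sum (hf : IsFinslerOn f U) (hx : x ∈ U) (hy : y ≠ 0)
    (u v : EuclideanSpace ℝ (Fin n)) :
    fundamentalForm (f x) y u v = ∑ i, v i * ∑ j, u j * g f i j x y := by
  have hc : ContDiffAt ℝ 2 (f x) y := by
    have := (hf.smooth.contDiffAt hf.isOpen hx hy).comp y
      ((contDiffAt_const (c := x)).prodMk contDiffAt_id)
    exact this.of_le (by norm_cast)
  rw [fundamentalForm_eq_fderiv hc]
  have h1 : (fun w => fderiv ℝ (fun w' => (1 / 2) * f x w' ^ 2) w v) =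
      fun w => ∑ i, v i * momentum f i x w := by
    funext w
    rw [clm_apply_eq_sum]
    rfl
  have h2 : HasFDerivAt (fun w => ∑ i, v i * momentum f i x w)
      (∑ i, v i • fderiv ℝ (fun w => momentum f i x w) y) y :=
    HasFDerivAt.fun_sum fun i _ =>
      ((hf.smooth_momentum i).differentiableAt_right hf.isOpen hx hy).hasFDerivAt.const_mul (v i)
  rw [h1, h2.fderiv, sum_apply]
  refine Finset.sum_congr rfl fun i _ => ?_
  rw [smul_apply, clm_apply_eq_sum]
  simp [hf.g_eq hx hy, pdy]

theorem g_mulVec_injective (hf : IsFinslerOn f U) (hx : x ∈ U) (hy : y ≠ 0) {w : Fin n → ℝ}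
    (hw : (Matrix.of fun a b => g f a b x y).mulVec w = 0) : w = 0 := by
  by_contra hne
  have hu : WithLp.toLp 2 w ≠ (0 : EuclideanSpace ℝ (Fin n)) := by
    intro h; exact hne (by simpa using congrArg WithLp.ofLp h)
  have hpos := hf.posDef x hx y _ hy hu
  rw [hf.fundamentalForm_eq_sum hx hy] at hpos
  refine hpos.ne' (Finset.sum_eq_zero fun i _ => ?_)
  have := congrFun hw i
  simp only [Matrix.mulVec, dotProduct, Matrix.of_apply, Pi.zero_apply] at this
  rw [mul_eq_zero]; right
  simpa [mul_comm] using this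

theorem isUnit_g (hf : IsFinslerOn f U) (hx : x ∈ U) (hy : y ≠ 0) :
    IsUnit (Matrix.of fun a b => g f a b x y) := by
  rw [← Matrix.mulVec_injective_iff_isUnit]
  intro w w' h
  refine sub_eq_zero.1 (hf.g_mulVec_injective hx hy ?_)
  rw [Matrix.mulVec_sub, sub_eq_zero]
  exact h

/-- The geodesic equation of the Chern connection is the Euler-Lagrange equation of the energy. -/
theorem geodesic_iff_euler_lagrange (hf : IsFinslerOn f U) (hx : x ∈ U) (hy : y ≠ 0)
    (w : EuclideanSpace ℝ (Fin n)) :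
    (∀ i, w i + ∑ j, ∑ k, y j * y k * chernChristoffel f i j k x y = 0) ↔
      ∀ l, fderiv ℝ (fun p : EuclideanSpace ℝ (Fin n) × EuclideanSpace ℝ (Fin n) =>
        momentum f l p.1 p.2) (x, y) (y, w) = pdx l (energy f) x y := by
  set M : Matrix (Fin n) (Fin n) ℝ := Matrix.of fun a b => g f a b x y with hM
  set b : Fin n → ℝ := fun l => ∑ k, y k * pdx k (momentum f l) x y - pdx l (energy f) x y
    with hb
  have h1 : (∀ i, w i + ∑ j, ∑ k, y j * y k * chernChristoffel f i j k x y = 0) ↔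
      w.ofLp + M⁻¹.mulVec b = 0 := by
    rw [funext_iff]
    refine forall_congr' fun i => ?_
    rw [hf.sum_chernChristoffel hx hy]
    rfl
  -- By the chain rule the Euler–Lagrange defect is M w + b, which is M applied to the Chern
  -- expression w + M⁻¹ b.
  have h2 : (∀ l, fderiv ℝ (fun p : EuclideanSpace ℝ (Fin n) × EuclideanSpace ℝ (Fin n) =>
        momentum f l p.1 p.2) (x, y) (y, w) = pdx l (energy f) x y) ↔
      M.mulVec (w.ofLp + M⁻¹.mulVec b) = 0 := by
    have hu : M * M⁻¹ = 1 :=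
      Matrix.mul_nonsing_inv M ((Matrix.isUnit_iff_isUnit_det _).1 (hf.isUnit_g hx hy))
    rw [Matrix.mulVec_add, Matrix.mulVec_mulVec, hu, Matrix.one_mulVec, funext_iff]
    refine forall_congr' fun l => ?_
    rw [(hf.smooth_momentum l).fderiv_eq_sum hf.isOpen hx hy]
    simp only [← hf.g_eq hx hy, Pi.add_apply, Matrix.mulVec, dotProduct, hM, Matrix.of_apply, hb,
      Pi.zero_apply]
    rw [Finset.sum_congr rfl fun k _ => mul_comm (w k) _]
    constructor <;> intro h <;> linarith
  rw [h1, h2]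
  exact ⟨fun h => by rw [h, Matrix.mulVec_zero], fun h => hf.g_mulVec_injective hx hy h⟩

/-- Euler's identities give g_y(y, y) = f², and the left side is positive. -/
theorem ne_zero (hf : IsFinslerOn f U) (hx : x ∈ U) (hy : y ≠ 0) : f x y ≠ 0 := by
  intro h0
  have hpos := hf.posDef x hx y y hy hy
  rw [hf.fundamentalForm_eq_sum hx hy] at hpos
  simp only [hf.sum_g hx hy, hf.sum_momentum hx hy, energy, h0] at hpos
  simp at hpos

end IsFinslerOn

/-! ### Noether's theorem for left-invariant fields, in coordinates -/

section BiInvariant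

open Filter Topology

/-- The coordinate expression of a bi-invariant Finsler metric: `m` is the multiplication of a Lie
group, with the left factor read in a chart with image `U` and the right factor in a chart around
the identity sending it to `z₀`, and `f₀` is the metric on the Lie algebra. -/
structure IsBiInvariantOn
    (f : EuclideanSpace ℝ (Fin n) → EuclideanSpace ℝ (Fin n) → ℝ)
    (U : Set (EuclideanSpace ℝ (Fin n)))
    (m : EuclideanSpace ℝ (Fin n) → EuclideanSpace ℝ (Fin n) → EuclideanSpace ℝ (Fin n))
    (z₀ : EuclideanSpace ℝ (Fin n)) (f₀ : EuclideanSpace ℝ (Fin n) → ℝ) : Prop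
    extends IsFinslerOn f U where
  smooth_mul : ∀ x ∈ U, ContDiffAt ℝ ∞
    (fun p : EuclideanSpace ℝ (Fin n) × EuclideanSpace ℝ (Fin n) => m p.1 p.2) (x, z₀)
  mul_one : ∀ x ∈ U, m x z₀ = x
  right_invariant : ∀ x ∈ U, ∀ᶠ z in 𝓝 z₀, ∀ y,
    f (m x z) (fderiv ℝ (fun x' => m x' z) x y) = f x y
  left_invariant : ∀ x ∈ U, ∀ Z, f x (fderiv ℝ (m x) z₀ Z) = f₀ Z
  smooth_algebra : ∀ y, y ≠ 0 → ContDiffAt ℝ ∞ f₀ y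
  posDef_algebra : ∀ y u, y ≠ 0 → u ≠ 0 → 0 < fundamentalForm f₀ y u u
  ne_zero_algebra : ∀ y, y ≠ 0 → f₀ y ≠ 0

namespace IsBiInvariantOn

variable {f : EuclideanSpace ℝ (Fin n) → EuclideanSpace ℝ (Fin n) → ℝ}
  {U : Set (EuclideanSpace ℝ (Fin n))}
  {m : EuclideanSpace ℝ (Fin n) → EuclideanSpace ℝ (Fin n) → EuclideanSpace ℝ (Fin n)}
  {z₀ : EuclideanSpace ℝ (Fin n)} {f₀ : EuclideanSpace ℝ (Fin n) → ℝ}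
  {x y : EuclideanSpace ℝ (Fin n)}

theorem hasFDerivAt_mul_right (hx : DifferentiableAt ℝ
      (fun p : EuclideanSpace ℝ (Fin n) × EuclideanSpace ℝ (Fin n) => m p.1 p.2) (x, y)) :
    HasFDerivAt (m x) ((fderiv ℝ
      (fun p : EuclideanSpace ℝ (Fin n) × EuclideanSpace ℝ (Fin n) => m p.1 p.2) (x, y)).comp
      (ContinuousLinearMap.inr ℝ _ _)) y :=
  HasFDerivAt.comp (f := fun y' => (x, y')) y hx.hasFDerivAt
    (hasFDerivAt_prodMk_right x y)

theorem hasFDerivAt_mul_left (hx : DifferentiableAt ℝ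
      (fun p : EuclideanSpace ℝ (Fin n) × EuclideanSpace ℝ (Fin n) => m p.1 p.2) (x, y)) :
    HasFDerivAt (fun x' => m x' y) ((fderiv ℝ
      (fun p : EuclideanSpace ℝ (Fin n) × EuclideanSpace ℝ (Fin n) => m p.1 p.2) (x, y)).comp
      (ContinuousLinearMap.inl ℝ _ _)) x :=
  HasFDerivAt.comp (f := fun x' => (x', y)) x hx.hasFDerivAt
    (hasFDerivAt_prodMk_left x y)

/-- The frame of left-invariant vector fields is smooth. -/
theorem contDiffAt_frame (hm : IsBiInvariantOn f U m z₀ f₀) (hx : x ∈ U) :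
    ContDiffAt ℝ ∞ (fun x' => fderiv ℝ (m x') z₀) x :=
  ContDiffAt.fderiv (f := m) (g := fun _ => z₀) (n := ∞) (hm.smooth_mul x hx) contDiffAt_const
    (by simp)

/-- The metric detects the kernel: a vector Z sent to 0 has f₀ Z = f x 0 = 0, whereas f₀ vanishes at
no nonzero vector. -/
theorem frame_injective (hm : IsBiInvariantOn f U m z₀ f₀) (hx : x ∈ U) :
    Function.Injective (fderiv ℝ (m x) z₀) := by
  rw [injective_iff_map_eq_zero]
  intro Z hZ
  by_contra hne
  refine hm.ne_zero_algebra Z hne ?_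
  rw [← hm.left_invariant x hx, hZ]
  simpa using hm.homogeneous x hx 0 0 le_rfl

/-- The left-invariant frame as a linear equivalence. -/
theorem exists_frame_equiv (hm : IsBiInvariantOn f U m z₀ f₀) (hx : x ∈ U) :
    ∃ e : EuclideanSpace ℝ (Fin n) ≃L[ℝ] EuclideanSpace ℝ (Fin n),
      (e : EuclideanSpace ℝ (Fin n) →L[ℝ] EuclideanSpace ℝ (Fin n)) = fderiv ℝ (m x) z₀ := by
  refine ⟨(LinearEquiv.ofInjectiveEndo (fderiv ℝ (m x) z₀ : EuclideanSpace ℝ (Fin n) →ₗ[ℝ] _)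
    (hm.frame_injective hx)).toContinuousLinearEquiv, ?_⟩
  ext1 Z
  rfl

/-- Left-invariant vector fields are Killing fields. -/
theorem fderiv_energy_frame (hm : IsBiInvariantOn f U m z₀ f₀) (hx : x ∈ U) (hy : y ≠ 0)
    (Z : EuclideanSpace ℝ (Fin n)) :
    fderiv ℝ (fun p : EuclideanSpace ℝ (Fin n) × EuclideanSpace ℝ (Fin n) => energy f p.1 p.2)
      (x, y) (fderiv ℝ (m x) z₀ Z, fderiv ℝ (fun x' => fderiv ℝ (m x') z₀ Z) x y) = 0 := by
  set M := fun p : EuclideanSpace ℝ (Fin n) × EuclideanSpace ℝ (Fin n) => m p.1 p.2 with hM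
  have hsm : ContDiffAt ℝ ∞ M (x, z₀) := hm.smooth_mul x hx
  have hev : ∀ᶠ p in 𝓝 (x, z₀), DifferentiableAt ℝ M p := by
    filter_upwards [(hsm.of_le (m := 1) (by norm_cast)).eventually (by simp)] with p hp
      using hp.differentiableAt (by simp)
  have hDM : DifferentiableAt ℝ (fderiv ℝ M) (x, z₀) :=
    (hsm.fderiv_right (m := 1) (by norm_cast)).differentiableAt (by simp)
  -- The second factor moves through the identity in direction Z. The maps x' ↦ m x' (z₀ + s Z) are
  -- right translations, and their s-derivative at 0 is the left-invariant field of Z.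
  have hpath : HasDerivAt (fun s : ℝ => (x, z₀ + s • Z)) (0, Z) 0 := by
    refine (hasDerivAt_const (0 : ℝ) x).prodMk ?_
    simpa using ((hasDerivAt_id (0 : ℝ)).smul_const Z).const_add z₀
  have hpath0 : (x, z₀ + (0 : ℝ) • Z) = (x, z₀) := by simp
  have hptend : Tendsto (fun s : ℝ => (x, z₀ + s • Z)) (𝓝 0) (𝓝 (x, z₀)) := by
    rw [← hpath0]; exact hpath.continuousAt
  have hA : ∀ᶠ x' in 𝓝 x, fderiv ℝ (m x') z₀ Z = fderiv ℝ M (x', z₀) (0, Z) := by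
    have : Tendsto (fun x' => (x', z₀)) (𝓝 x) (𝓝 (x, z₀)) :=
      (Continuous.prodMk_left z₀).continuousAt
    filter_upwards [this.eventually hev] with x' hx'
    rw [(hasFDerivAt_mul_right hx').fderiv]
    simp [hM]
  have hDA : fderiv ℝ (fun x' => fderiv ℝ (m x') z₀ Z) x y =
      fderiv ℝ (fderiv ℝ M) (x, z₀) (y, 0) (0, Z) := by
    have h1 : HasFDerivAt (fun x' => fderiv ℝ M (x', z₀))
        ((fderiv ℝ (fderiv ℝ M) (x, z₀)).comp (ContinuousLinearMap.inl ℝ _ _)) x :=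
      HasFDerivAt.comp (f := fun x' => (x', z₀)) x hDM.hasFDerivAt (hasFDerivAt_prodMk_left x z₀)
    have h2 := h1.clm_apply (hasFDerivAt_const ((0, Z) : EuclideanSpace ℝ (Fin n) ×
      EuclideanSpace ℝ (Fin n)) x)
    rw [EventuallyEq.fderiv_eq hA, h2.fderiv]
    simp
  have hfst : HasDerivAt (fun s : ℝ => m x (z₀ + s • Z)) (fderiv ℝ (m x) z₀ Z) 0 := by
    have h1 : HasFDerivAt M (fderiv ℝ M (x, z₀)) (x, z₀ + (0 : ℝ) • Z) := by
      rw [hpath0]; exact (hsm.differentiableAt (by simp)).hasFDerivAt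
    rw [hA.self_of_nhds]
    exact h1.comp_hasDerivAt (0 : ℝ) hpath
  have hsnd : HasDerivAt (fun s : ℝ => fderiv ℝ (fun x' => m x' (z₀ + s • Z)) x y)
      (fderiv ℝ (fun x' => fderiv ℝ (m x') z₀ Z) x y) 0 := by
    have h1 : HasFDerivAt (fderiv ℝ M) (fderiv ℝ (fderiv ℝ M) (x, z₀)) (x, z₀ + (0 : ℝ) • Z) := by
      rw [hpath0]; exact hDM.hasFDerivAt
    have h2 : HasDerivAt (fun s : ℝ => fderiv ℝ M (x, z₀ + s • Z))
        (fderiv ℝ (fderiv ℝ M) (x, z₀) (0, Z)) 0 := h1.comp_hasDerivAt (0 : ℝ) hpath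
    have h3 := h2.clm_apply (hasDerivAt_const (0 : ℝ) ((y, 0) : EuclideanSpace ℝ (Fin n) ×
      EuclideanSpace ℝ (Fin n)))
    -- Symmetry of mixed second derivatives: the s-derivative of the differential of right
    -- translation, applied to y, is the derivative of the left-invariant field along y.
    have hsymm : fderiv ℝ (fderiv ℝ M) (x, z₀) (0, Z) (y, 0) =
        fderiv ℝ (fderiv ℝ M) (x, z₀) (y, 0) (0, Z) :=
      hsm.isSymmSndFDerivAt (by rw [minSmoothness_of_isRCLikeNormedField]; norm_cast) _ _
    rw [map_zero, add_zero, hsymm, ← hDA] at h3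
    refine h3.congr_of_eventuallyEq ?_
    filter_upwards [hptend.eventually hev] with s hs
    rw [(hasFDerivAt_mul_left hs).fderiv]
    simp [hM]
  have hval : (m x (z₀ + (0 : ℝ) • Z), fderiv ℝ (fun x' => m x' (z₀ + (0 : ℝ) • Z)) x y) =
      (x, y) := by
    have : (fun x' => m x' z₀) =ᶠ[𝓝 x] id := by
      filter_upwards [hm.isOpen.mem_nhds hx] with x' hx' using hm.mul_one x' hx'
    simp only [zero_smul, add_zero]
    rw [hm.mul_one x hx, this.fderiv_eq, fderiv_id]
    rfl
  have hL : HasFDerivAt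
      (fun p : EuclideanSpace ℝ (Fin n) × EuclideanSpace ℝ (Fin n) => energy f p.1 p.2)
      (fderiv ℝ (fun p : EuclideanSpace ℝ (Fin n) × EuclideanSpace ℝ (Fin n) => energy f p.1 p.2)
        (x, y))
      (m x (z₀ + (0 : ℝ) • Z), fderiv ℝ (fun x' => m x' (z₀ + (0 : ℝ) • Z)) x y) := by
    rw [hval]; exact hm.smooth_energy.hasFDerivAt hm.isOpen hx hy
  have hcomp := hL.comp_hasDerivAt (0 : ℝ) (hfst.prodMk hsnd)
  -- By right invariance the energy is constant along the path of translated tangent vectors.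
  refine hcomp.unique ((hasDerivAt_const (0 : ℝ) (energy f x y)).congr_of_eventuallyEq ?_)
  have hz : Tendsto (fun s : ℝ => z₀ + s • Z) (𝓝 0) (𝓝 z₀) := by
    have : Continuous fun s : ℝ => z₀ + s • Z := by fun_prop
    simpa using this.tendsto 0
  filter_upwards [hz.eventually (hm.right_invariant x hx)] with s hs
  simp [energy, hs y]

/-- The momentum, paired with the left-invariant fields, only depends on the left trivialization of
the velocity. -/
theorem sum_momentum_frame (hm : IsBiInvariantOn f U m z₀ f₀) (hx : x ∈ U)
    {η : EuclideanSpace ℝ (Fin n)} (hη : η ≠ 0) (Z : EuclideanSpace ℝ (Fin n)) :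
    ∑ l, fderiv ℝ (m x) z₀ Z l * momentum f l x (fderiv ℝ (m x) z₀ η) =
      fderiv ℝ (fun w => (1 / 2) * f₀ w ^ 2) η Z := by
  have hne : fderiv ℝ (m x) z₀ η ≠ 0 := fun h => hη (hm.frame_injective hx (by simpa using h))
  have h1 : (fun w => (1 / 2) * f₀ w ^ 2) = (energy f x) ∘ fderiv ℝ (m x) z₀ := by
    funext w; simp [energy, hm.left_invariant x hx]
  have hd := hm.smooth_energy.differentiableAt_right hm.isOpen hx hne
  rw [h1, fderiv_comp _ hd (fderiv ℝ (m x) z₀).differentiableAt, ContinuousLinearMap.fderiv,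
    ContinuousLinearMap.comp_apply, clm_apply_eq_sum _ (fderiv ℝ (m x) z₀ Z)]
  rfl

variable {J : Set ℝ} {t : ℝ} {c v ξ : ℝ → EuclideanSpace ℝ (Fin n)}
  {w ξ' : EuclideanSpace ℝ (Fin n)}

/-- Noether's theorem for the left-invariant fields, before restricting to geodesics. -/
theorem sum_euler_lagrange_frame (hm : IsBiInvariantOn f U m z₀ f₀)
    (hJ : UniqueDiffWithinAt ℝ J t) (ht : t ∈ J) (hU : c t ∈ U) (hv0 : v t ≠ 0)
    (hc : HasDerivWithinAt c (v t) J t) (hv : HasDerivWithinAt v w J t)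
    (hξ : HasDerivWithinAt ξ ξ' J t)
    (hvξ : ∀ᶠ s in 𝓝[J] t, v s = fderiv ℝ (m (c s)) z₀ (ξ s)) (Z : EuclideanSpace ℝ (Fin n)) :
    ∑ l, fderiv ℝ (m (c t)) z₀ Z l *
      (fderiv ℝ (fun p : EuclideanSpace ℝ (Fin n) × EuclideanSpace ℝ (Fin n) =>
        momentum f l p.1 p.2) (c t, v t) (v t, w) - pdx l (energy f) (c t) (v t)) =
      fundamentalForm f₀ (ξ t) ξ' Z := by
  have hvt : v t = fderiv ℝ (m (c t)) z₀ (ξ t) := hvξ.self_of_nhdsWithin ht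
  have hξ0 : ξ t ≠ 0 := by
    intro h; rw [h, map_zero] at hvt; exact hv0 hvt
  have hA : HasFDerivAt (fun x' => fderiv ℝ (m x') z₀ Z)
      (fderiv ℝ (fun x' => fderiv ℝ (m x') z₀ Z) (c t)) (c t) :=
    (((hm.contDiffAt_frame hU).differentiableAt (by simp)).clm_apply
      (differentiableAt_const Z)).hasFDerivAt
  have hAc := hA.comp_hasDerivWithinAt t hc
  have hAl : ∀ l, HasDerivWithinAt (fun s => fderiv ℝ (m (c s)) z₀ Z l)
      (fderiv ℝ (fun x' => fderiv ℝ (m x') z₀ Z) (c t) (v t) l) J t := fun l =>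
    (EuclideanSpace.proj l : EuclideanSpace ℝ (Fin n) →L[ℝ] ℝ).hasFDerivAt.comp_hasDerivWithinAt
      t hAc
  have hp : ∀ l, HasDerivWithinAt (fun s => momentum f l (c s) (v s))
      (fderiv ℝ (fun p : EuclideanSpace ℝ (Fin n) × EuclideanSpace ℝ (Fin n) =>
        momentum f l p.1 p.2) (c t, v t) (v t, w)) J t := fun l =>
    HasFDerivAt.comp_hasDerivWithinAt (f := fun s => (c s, v s)) t
      ((hm.smooth_momentum l).hasFDerivAt hm.isOpen hU hv0) (hc.prodMk hv)
  have hsum : HasDerivWithinAt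
      (fun s => ∑ l, fderiv ℝ (m (c s)) z₀ Z l * momentum f l (c s) (v s))
      (∑ l, (fderiv ℝ (fun x' => fderiv ℝ (m x') z₀ Z) (c t) (v t) l * momentum f l (c t) (v t) +
        fderiv ℝ (m (c t)) z₀ Z l *
          fderiv ℝ (fun p : EuclideanSpace ℝ (Fin n) × EuclideanSpace ℝ (Fin n) =>
            momentum f l p.1 p.2) (c t, v t) (v t, w))) J t :=
    HasDerivWithinAt.fun_sum fun l _ => (hAl l).mul (hp l)
  have hf₀ := hm.smooth_algebra _ hξ0
  have he₀ : ContDiffAt ℝ ∞ (fun w => (1 / 2) * f₀ w ^ 2) (ξ t) :=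
    contDiffAt_const.mul (hf₀.pow 2)
  have hD : HasFDerivAt (fun η => fderiv ℝ (fun w => (1 / 2) * f₀ w ^ 2) η Z)
      (fderiv ℝ (fun η => fderiv ℝ (fun w => (1 / 2) * f₀ w ^ 2) η Z) (ξ t)) (ξ t) :=
    (((he₀.fderiv_right (m := 1) (by norm_cast)).differentiableAt (by simp)).clm_apply
      (differentiableAt_const Z)).hasFDerivAt
  have hξe := hD.comp_hasDerivWithinAt t hξ
  have heq : ∀ s, c s ∈ U → ξ s ≠ 0 → v s = fderiv ℝ (m (c s)) z₀ (ξ s) →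
      ∑ l, fderiv ℝ (m (c s)) z₀ Z l * momentum f l (c s) (v s) =
        fderiv ℝ (fun w => (1 / 2) * f₀ w ^ 2) (ξ s) Z := by
    intro s h1 h2 h3
    rw [h3]; exact hm.sum_momentum_frame h1 h2 Z
  have hev : (fun s => ∑ l, fderiv ℝ (m (c s)) z₀ Z l * momentum f l (c s) (v s)) =ᶠ[𝓝[J] t]
      fun s => fderiv ℝ (fun w => (1 / 2) * f₀ w ^ 2) (ξ s) Z := by
    filter_upwards [hc.continuousWithinAt.eventually (hm.isOpen.mem_nhds hU),
      hξ.continuousWithinAt.eventually (isOpen_ne.mem_nhds hξ0), hvξ] with s h1 h2 h3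
      using heq s h1 h2 h3
  -- The pairing of the momentum with the field of Z is differentiated in two ways: by the product
  -- rule in the chart, and through ξ on the Lie algebra.
  have hkey := hJ.eq_deriv _ hsum (hξe.congr_of_eventuallyEq hev (heq t hU hξ0 hvt))
  rw [fundamentalForm_eq_fderiv (hf₀.of_le (by norm_cast)), ← hkey]
  -- The Killing identity replaces the product-rule term containing the derivative of the field by
  -- minus the x-derivative of the energy along the field.
  have hkill := hm.fderiv_energy_frame hU hv0 Z
  rw [hm.smooth_energy.fderiv_eq_sum hm.isOpen hU hv0] at hkill
  simp only [mul_sub, Finset.sum_sub_distrib, Finset.sum_add_distrib]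
  have : ∑ l, fderiv ℝ (fun x' => fderiv ℝ (m x') z₀ Z) (c t) (v t) l *
      momentum f l (c t) (v t) =
      ∑ l, fderiv ℝ (fun x' => fderiv ℝ (m x') z₀ Z) (c t) (v t) l *
        pdy l (energy f) (c t) (v t) := rfl
  linarith

/-- The left trivialization of the velocity is differentiable. -/
theorem differentiableWithinAt_of_frame (hm : IsBiInvariantOn f U m z₀ f₀) (ht : t ∈ J)
    (hU : c t ∈ U) (hc : DifferentiableWithinAt ℝ c J t) (hv : DifferentiableWithinAt ℝ v J t)
    (hvξ : ∀ᶠ s in 𝓝[J] t, v s = fderiv ℝ (m (c s)) z₀ (ξ s)) :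
    DifferentiableWithinAt ℝ ξ J t := by
  obtain ⟨e, he⟩ := hm.exists_frame_equiv hU
  have h1 : DifferentiableAt ℝ (fun x' => (fderiv ℝ (m x') z₀).inverse) (c t) := by
    have hinv : ContDiffAt ℝ 1 ContinuousLinearMap.inverse (fderiv ℝ (m (c t)) z₀) := by
      rw [← he]; exact contDiffAt_map_inverse e
    exact DifferentiableAt.comp (c t) (hinv.differentiableAt (by simp))
      ((hm.contDiffAt_frame hU).differentiableAt (by simp))
  have h2 : DifferentiableWithinAt ℝ (fun s => (fderiv ℝ (m (c s)) z₀).inverse (v s)) J t :=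
    (h1.comp_differentiableWithinAt t hc).clm_apply hv
  have hinv : ∀ s, c s ∈ U → v s = fderiv ℝ (m (c s)) z₀ (ξ s) →
      ξ s = (fderiv ℝ (m (c s)) z₀).inverse (v s) := by
    intro s h1 h2
    obtain ⟨e', he'⟩ := hm.exists_frame_equiv h1
    rw [h2, ← he']
    simp
  refine h2.congr_of_eventuallyEq ?_ (hinv t hU (hvξ.self_of_nhdsWithin ht))
  filter_upwards [hc.continuousWithinAt.eventually (hm.isOpen.mem_nhds hU), hvξ] with s h1 h2
    using hinv s h1 h2

/-- A curve satisfies the geodesic equation of a bi-invariant Finsler metric exactly when the left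
trivialization of its velocity has zero derivative. -/
theorem geodesic_iff_derivWithin_eq_zero (hm : IsBiInvariantOn f U m z₀ f₀)
    (hJ : UniqueDiffWithinAt ℝ J t) (ht : t ∈ J) (hU : c t ∈ U) (hv0 : v t ≠ 0)
    (hc : HasDerivWithinAt c (v t) J t) (hv : HasDerivWithinAt v w J t)
    (hvξ : ∀ᶠ s in 𝓝[J] t, v s = fderiv ℝ (m (c s)) z₀ (ξ s)) :
    (∀ i, w i + ∑ j, ∑ k, v t j * v t k * chernChristoffel f i j k (c t) (v t) = 0) ↔
      derivWithin ξ J t = 0 := by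
  have hξ := (hm.differentiableWithinAt_of_frame ht hU hc.differentiableWithinAt
    hv.differentiableWithinAt hvξ).hasDerivWithinAt
  have hξ0 : ξ t ≠ 0 := by
    intro h
    have hvt := hvξ.self_of_nhdsWithin ht
    rw [h, map_zero] at hvt; exact hv0 hvt
  have key := hm.sum_euler_lagrange_frame hJ ht hU hv0 hc hv hξ hvξ
  rw [hm.geodesic_iff_euler_lagrange hU hv0 w]
  constructor
  · intro h
    by_contra hne
    -- Noether's identity is tested on Z = ξ', which would give g_ξ(ξ', ξ') = 0.
    refine (hm.posDef_algebra _ _ hξ0 hne).ne' ?_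
    rw [← key]
    exact Finset.sum_eq_zero fun l _ => by rw [h l, sub_self, mul_zero]
  · intro h l
    obtain ⟨e, he⟩ := hm.exists_frame_equiv hU
    -- This Z has the l-th coordinate vector as its left-invariant field at the point, so the
    -- pairing isolates the l-th component of the defect.
    have hl := key (e.symm (EuclideanSpace.single l 1))
    rw [← he, h] at hl
    have hzero : fundamentalForm f₀ (ξ t) 0 (e.symm (EuclideanSpace.single l 1)) = 0 := by
      simp [fundamentalForm]
    rw [hzero] at hl
    simpa [Pi.single_apply, sub_eq_zero] using hl

end IsBiInvariantOn

end BiInvariant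

end FinslerCoord

/-! ### Passage between the manifold and its charts -/

section Charts

open Filter Topology

variable {n : ℕ} {M : Type*} [TopologicalSpace M] [ChartedSpace (EuclideanSpace ℝ (Fin n)) M]

/-- Stated for points of the tangent bundle, since the two derivatives lie in fibres over base
points that are only propositionally equal. -/
theorem tangentMap_congr_of_eventuallyEq {n' : ℕ} {N : Type*} [TopologicalSpace N]
    [ChartedSpace (EuclideanSpace ℝ (Fin n')) N] {f g : N → M} {x : N} (h : f =ᶠ[𝓝 x] g)
    (v : TangentSpace (𝓡 n') x) :
    tangentMap (𝓡 n') (𝓡 n) f ⟨x, v⟩ = tangentMap (𝓡 n') (𝓡 n) g ⟨x, v⟩ := by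
  have h1 : f x = g x := h.self_of_nhds
  have h2 : HEq (mfderiv (𝓡 n') (𝓡 n) f x v) (mfderiv (𝓡 n') (𝓡 n) g x v) := by
    rw [h.mfderiv_eq]
    exact HEq.rfl
  exact Bundle.TotalSpace.ext h1 h2

theorem OpenPartialHomeomorph.mdifferentiable_of_mem_maximalAtlas
    {φ : OpenPartialHomeomorph M (EuclideanSpace ℝ (Fin n))}
    (hφ : φ ∈ IsManifold.maximalAtlas (𝓡 n) ∞ M) : φ.MDifferentiable (𝓡 n) (𝓡 n) :=
  ⟨(contMDiffOn_of_mem_maximalAtlas hφ).mdifferentiableOn (by simp),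
    (contMDiffOn_symm_of_mem_maximalAtlas hφ).mdifferentiableOn (by simp)⟩

theorem chartCoord_hasDerivWithinAt {σ : ℝ → M} {J : Set ℝ} {t : ℝ}
    {φ : OpenPartialHomeomorph M (EuclideanSpace ℝ (Fin n))}
    (hφ : φ ∈ IsManifold.maximalAtlas (𝓡 n) ∞ M) (hσ : σ t ∈ φ.source)
    {v : TangentSpace (𝓡 n) (σ t)}
    (h : HasMFDerivWithinAt 𝓘(ℝ, ℝ) (𝓡 n) σ J t ((1 : ℝ →L[ℝ] ℝ).smulRight v)) :
    HasDerivWithinAt (fun s => φ (σ s)) (chartCoord φ (σ t) v) J t := by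
  have h1 : HasMFDerivAt (𝓡 n) (𝓡 n) φ (σ t) _ :=
    ((OpenPartialHomeomorph.mdifferentiable_of_mem_maximalAtlas hφ).mdifferentiableAt
      hσ).hasMFDerivAt
  have key : ∀ (D : EuclideanSpace ℝ (Fin n) →L[ℝ] EuclideanSpace ℝ (Fin n))
      (w : EuclideanSpace ℝ (Fin n)),
      HasFDerivWithinAt (fun s => φ (σ s)) (D.comp ((1 : ℝ →L[ℝ] ℝ).smulRight w)) J t →
      HasDerivWithinAt (fun s => φ (σ s)) (D w) J t := fun D w hD => by
    simpa using hD.hasDerivWithinAt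
  exact key (mfderiv (𝓡 n) (𝓡 n) φ (σ t)) v (h1.comp_hasMFDerivWithinAt t h).hasFDerivWithinAt

variable [IsManifold (𝓡 n) ∞ M]

theorem mfderiv_chartAt_self_apply (p : M) (v : TangentSpace (𝓡 n) p) :
    mfderiv (𝓡 n) (𝓡 n) (chartAt (EuclideanSpace ℝ (Fin n)) p) p v = v := by
  have h1 := mfderiv_chartAt_eq_tangentCoordChange (I := 𝓡 n)
    (mem_chart_source (EuclideanSpace ℝ (Fin n)) p)
  have h2 : tangentCoordChange (𝓡 n) p p p v = v :=
    tangentCoordChange_self (mem_extChartAt_source (I := 𝓡 n) p)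
  exact (DFunLike.congr_fun h1 v).trans h2

/-- The tangent space at p is modelled through the preferred chart at p. So F read in that chart
over the image of p is F on that tangent space itself; at the identity, this is the metric on the
Lie algebra. -/
theorem tangentMap_chartAt_symm_self (p : M) (v : TangentSpace (𝓡 n) p) :
    tangentMap (𝓡 n) (𝓡 n) (chartAt (EuclideanSpace ℝ (Fin n)) p).symm
      ⟨chartAt (EuclideanSpace ℝ (Fin n)) p p, v⟩ = ⟨p, v⟩ := by
  set ψ := chartAt (EuclideanSpace ℝ (Fin n)) p with hψ
  have hd := OpenPartialHomeomorph.mdifferentiable_of_mem_maximalAtlas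
    (IsManifold.chart_mem_maximalAtlas (I := 𝓡 n) (n := ∞) p)
  have h1 : tangentMap (𝓡 n) (𝓡 n) ψ ⟨p, v⟩ = ⟨ψ p, v⟩ := by
    exact Bundle.TotalSpace.ext rfl (heq_of_eq (mfderiv_chartAt_self_apply p v))
  rw [← h1, ← tangentMap_comp_at]
  · rw [tangentMap_congr_of_eventuallyEq (g := id), tangentMap_id]
    · rfl
    · filter_upwards [ψ.open_source.mem_nhds (mem_chart_source _ p)] with q hq
        using ψ.left_inv hq
  · exact hd.mdifferentiableAt_symm (ψ.map_source (mem_chart_source _ p))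
  · exact hd.mdifferentiableAt (mem_chart_source _ p)

theorem contMDiff_mk_tangentBundle_model :
    ContMDiff 𝓘(ℝ, EuclideanSpace ℝ (Fin n) × EuclideanSpace ℝ (Fin n)) (𝓡 n).tangent ∞
      (fun p : EuclideanSpace ℝ (Fin n) × EuclideanSpace ℝ (Fin n) =>
        (⟨p.1, p.2⟩ : TangentBundle (𝓡 n) (EuclideanSpace ℝ (Fin n)))) := by
  intro p
  rw [Bundle.contMDiffAt_totalSpace]
  refine ⟨contDiff_fst.contMDiff.contMDiffAt, ?_⟩
  have : (fun x : EuclideanSpace ℝ (Fin n) × EuclideanSpace ℝ (Fin n) =>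
      (trivializationAt (EuclideanSpace ℝ (Fin n))
        (TangentSpace (𝓡 n) : EuclideanSpace ℝ (Fin n) → Type) p.1
        (⟨x.1, x.2⟩ : TangentBundle (𝓡 n) (EuclideanSpace ℝ (Fin n)))).2) = Prod.snd := by
    funext x
    rw [trivializationAt_model_space_apply]
  rw [this]
  exact contDiff_snd.contMDiff.contMDiffAt

theorem contMDiffOn_tangentMap_chart_symm
    {φ : OpenPartialHomeomorph M (EuclideanSpace ℝ (Fin n))}
    (hφ : φ ∈ IsManifold.maximalAtlas (𝓡 n) ∞ M) :
    ContMDiffOn 𝓘(ℝ, EuclideanSpace ℝ (Fin n) × EuclideanSpace ℝ (Fin n)) (𝓡 n).tangent ∞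
      (fun p : EuclideanSpace ℝ (Fin n) × EuclideanSpace ℝ (Fin n) =>
        tangentMap (𝓡 n) (𝓡 n) φ.symm
          (⟨p.1, p.2⟩ : TangentBundle (𝓡 n) (EuclideanSpace ℝ (Fin n))))
      (φ.target ×ˢ Set.univ) := by
  have h1 := (contMDiffOn_symm_of_mem_maximalAtlas hφ).contMDiffOn_tangentMapWithin
    (m := ∞) (by simp) φ.open_target.uniqueMDiffOn
  refine (h1.comp contMDiff_mk_tangentBundle_model.contMDiffOn
    (fun p hp => hp.1)).congr fun p hp => ?_
  exact (tangentMapWithin_eq_tangentMap (φ.open_target.uniqueMDiffOn _ hp.1)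
    ((OpenPartialHomeomorph.mdifferentiable_of_mem_maximalAtlas hφ).mdifferentiableAt_symm
      hp.1)).symm

namespace FinslerMetric

variable (F : FinslerMetric n M)

/-- The differential of the inverse chart is linear and injective on fibres, so it keeps nonzero
vectors nonzero and transports homogeneity and positivity. -/
theorem isFinslerOn_inChart {φ : OpenPartialHomeomorph M (EuclideanSpace ℝ (Fin n))}
    (hφ : φ ∈ IsManifold.maximalAtlas (𝓡 n) ∞ M) :
    FinslerCoord.IsFinslerOn (F.inChart φ) φ.target := by
  have hd := OpenPartialHomeomorph.mdifferentiable_of_mem_maximalAtlas hφ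
  have hinj : ∀ x ∈ φ.target, ∀ y : EuclideanSpace ℝ (Fin n), y ≠ 0 →
      mfderiv (𝓡 n) (𝓡 n) φ.symm x y ≠ 0 := by
    intro x hx y hy h0
    exact hy (hd.symm.mfderiv_injective hx (h0.trans (map_zero _).symm))
  refine ⟨φ.open_target, ?_, ?_, ?_⟩
  · have h1 : ContMDiffOn 𝓘(ℝ, EuclideanSpace ℝ (Fin n) × EuclideanSpace ℝ (Fin n)) 𝓘(ℝ, ℝ) ∞
        (fun p : EuclideanSpace ℝ (Fin n) × EuclideanSpace ℝ (Fin n) => F.inChart φ p.1 p.2)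
        (φ.target ×ˢ {0}ᶜ) :=
      F.smooth_off_zero.comp ((contMDiffOn_tangentMap_chart_symm hφ).mono
        (Set.prod_mono_right (Set.subset_univ _))) fun p hp => hinj p.1 hp.1 p.2 hp.2
    exact h1.contDiffOn
  · intro x _ y t ht
    have h1 : mfderiv (𝓡 n) (𝓡 n) φ.symm x (t • y : EuclideanSpace ℝ (Fin n)) =
        t • mfderiv (𝓡 n) (𝓡 n) φ.symm x y := map_smul _ t _
    rw [inChart, h1]
    exact F.homogeneous _ _ _ ht
  · intro x hx y u hy hu
    have h1 := F.posDef (φ.symm x) _ _ (hinj x hx y hy) (hinj x hx u hu)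
    have h2 : ∀ s t : ℝ, mfderiv (𝓡 n) (𝓡 n) φ.symm x
        (y + s • u + t • u : EuclideanSpace ℝ (Fin n)) =
        mfderiv (𝓡 n) (𝓡 n) φ.symm x y + s • mfderiv (𝓡 n) (𝓡 n) φ.symm x u +
          t • mfderiv (𝓡 n) (𝓡 n) φ.symm x u := by
      intro s t
      exact ((map_add _ _ _).trans (congrArg₂ _ (map_add _ _ _) rfl)).trans
        (congrArg₂ _ (congrArg₂ _ rfl (map_smul _ s _)) (map_smul _ t _))
    simp only [fundamentalForm, inChart] at h1 ⊢
    simp only [h2]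
    exact h1

theorem toFun_ne_zero (p : M) {v : TangentSpace (𝓡 n) p} (hv : v ≠ 0) : F.toFun ⟨p, v⟩ ≠ 0 := by
  have h1 := (F.isFinslerOn_inChart (IsManifold.chart_mem_maximalAtlas p)).ne_zero
    (mem_chart_target _ p) (y := v) hv
  exact fun h0 => h1 ((congrArg F.toFun (tangentMap_chartAt_symm_self p v)).trans h0)

end FinslerMetric

end Charts

/-! ### Bi-invariance in charts -/

section LieGroups

open Filter Topology

variable {n : ℕ} {G : Type*} [TopologicalSpace G] [ChartedSpace (EuclideanSpace ℝ (Fin n)) G]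
  [Group G]

/-- The multiplication of a Lie group, with the left factor read in the chart `φ` and the right one
in the preferred chart at the identity. -/
noncomputable def localMul (φ : OpenPartialHomeomorph G (EuclideanSpace ℝ (Fin n)))
    (x z : EuclideanSpace ℝ (Fin n)) : EuclideanSpace ℝ (Fin n) :=
  φ (φ.symm x * (chartAt (EuclideanSpace ℝ (Fin n)) (1 : G)).symm z)

theorem localMul_one
    {φ : OpenPartialHomeomorph G (EuclideanSpace ℝ (Fin n))} {x : EuclideanSpace ℝ (Fin n)}
    (hx : x ∈ φ.target) :
    localMul φ x (chartAt (EuclideanSpace ℝ (Fin n)) (1 : G) 1) = x := by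
  rw [localMul, (chartAt _ (1 : G)).left_inv (mem_chart_source _ _), mul_one, φ.right_inv hx]

variable [LieGroup (𝓡 n) ∞ G] {φ : OpenPartialHomeomorph G (EuclideanSpace ℝ (Fin n))}

theorem contDiffAt_localMul (hφ : φ ∈ IsManifold.maximalAtlas (𝓡 n) ∞ G)
    {x z : EuclideanSpace ℝ (Fin n)} (hx : x ∈ φ.target)
    (hz : z ∈ (chartAt (EuclideanSpace ℝ (Fin n)) (1 : G)).target)
    (hxz : φ.symm x * (chartAt (EuclideanSpace ℝ (Fin n)) (1 : G)).symm z ∈ φ.source) :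
    ContDiffAt ℝ ∞ (fun p : EuclideanSpace ℝ (Fin n) × EuclideanSpace ℝ (Fin n) =>
      localMul φ p.1 p.2) (x, z) := by
  have h1 : ContMDiffAt 𝓘(ℝ, EuclideanSpace ℝ (Fin n) × EuclideanSpace ℝ (Fin n)) (𝓡 n) ∞
      (fun p : EuclideanSpace ℝ (Fin n) × EuclideanSpace ℝ (Fin n) => φ.symm p.1) (x, z) :=
    ContMDiffAt.comp (x, z) (f := Prod.fst) ((contMDiffOn_symm_of_mem_maximalAtlas hφ).contMDiffAt
      (φ.open_target.mem_nhds hx)) contDiff_fst.contMDiff.contMDiffAt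
  have h2 : ContMDiffAt 𝓘(ℝ, EuclideanSpace ℝ (Fin n) × EuclideanSpace ℝ (Fin n)) (𝓡 n) ∞
      (fun p : EuclideanSpace ℝ (Fin n) × EuclideanSpace ℝ (Fin n) =>
        (chartAt (EuclideanSpace ℝ (Fin n)) (1 : G)).symm p.2) (x, z) :=
    ContMDiffAt.comp (x, z) (f := Prod.snd)
      ((contMDiffOn_symm_of_mem_maximalAtlas (IsManifold.chart_mem_maximalAtlas 1)).contMDiffAt
      ((chartAt (EuclideanSpace ℝ (Fin n)) (1 : G)).open_target.mem_nhds hz))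
      contDiff_snd.contMDiff.contMDiffAt
  have h3 := ContMDiffAt.comp (x, z) (g := φ)
    (f := fun p : EuclideanSpace ℝ (Fin n) × EuclideanSpace ℝ (Fin n) =>
      φ.symm p.1 * (chartAt (EuclideanSpace ℝ (Fin n)) (1 : G)).symm p.2)
    ((contMDiffOn_of_mem_maximalAtlas hφ).contMDiffAt (φ.open_source.mem_nhds hxz)) (h1.mul h2)
  exact h3.contDiffAt

theorem eventually_localMul_mem {x : EuclideanSpace ℝ (Fin n)} (hx : x ∈ φ.target) :
    ∀ᶠ z in 𝓝 (chartAt (EuclideanSpace ℝ (Fin n)) (1 : G) 1),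
      z ∈ (chartAt (EuclideanSpace ℝ (Fin n)) (1 : G)).target ∧
      φ.symm x * (chartAt (EuclideanSpace ℝ (Fin n)) (1 : G)).symm z ∈ φ.source := by
  set ψ := chartAt (EuclideanSpace ℝ (Fin n)) (1 : G) with hψ
  have hz : ψ 1 ∈ ψ.target := mem_chart_target _ _
  refine Filter.Eventually.and (ψ.open_target.mem_nhds hz) ?_
  have hc : ContinuousAt (fun z => φ.symm x * ψ.symm z) (ψ 1) := by
    have : ContinuousMul G := continuousMul_of_contMDiffMul (𝓡 n) ∞
    exact continuousAt_const.mul (ψ.continuousAt_symm hz)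
  refine hc.eventually (φ.open_source.mem_nhds ?_)
  have h1 : φ.symm x * ψ.symm (ψ 1) = φ.symm x := by
    rw [ψ.left_inv (mem_chart_source _ _), mul_one]
  simpa only [h1] using φ.map_target hx

/-- The chart expression of a left-invariant vector field. -/
theorem chartCoord_mulInvariantVectorField (hφ : φ ∈ IsManifold.maximalAtlas (𝓡 n) ∞ G)
    {g : G} (hg : g ∈ φ.source) (X : GroupLieAlgebra (𝓡 n) G) :
    chartCoord φ g (mulInvariantVectorField X g) =
      fderiv ℝ (localMul φ (φ g)) (chartAt (EuclideanSpace ℝ (Fin n)) (1 : G) 1)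
        (X : EuclideanSpace ℝ (Fin n)) := by
  set ψ := chartAt (EuclideanSpace ℝ (Fin n)) (1 : G) with hψ
  have hd := OpenPartialHomeomorph.mdifferentiable_of_mem_maximalAtlas hφ
  have hdψ := OpenPartialHomeomorph.mdifferentiable_of_mem_maximalAtlas
    (IsManifold.chart_mem_maximalAtlas (I := 𝓡 n) (n := ∞) (1 : G))
  have h1 : tangentMap (𝓡 n) (𝓡 n) (localMul φ (φ g))
      ⟨ψ 1, (X : EuclideanSpace ℝ (Fin n))⟩ =
      tangentMap (𝓡 n) (𝓡 n) φ (tangentMap (𝓡 n) (𝓡 n) (fun h => g * h) ⟨1, X⟩) := by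
    have hfun : localMul φ (φ g) = (φ ∘ fun h => g * h) ∘ ψ.symm := by
      funext z; simp [localMul, φ.left_inv hg, hψ]
    have hφ1 : MDifferentiableAt (𝓡 n) (𝓡 n) φ (g * 1) := by
      rw [mul_one]; exact hd.mdifferentiableAt hg
    have hcomp : MDifferentiableAt (𝓡 n) (𝓡 n) (φ ∘ fun h => g * h) (1 : G) :=
      hφ1.comp 1 (mdifferentiableAt_mul_left)
    have hcomp' : MDifferentiableAt (𝓡 n) (𝓡 n) (φ ∘ fun h => g * h) (ψ.symm (ψ 1)) := by
      rw [ψ.left_inv (mem_chart_source _ _)]; exact hcomp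
    rw [hfun]
    refine (tangentMap_comp_at (I' := 𝓡 n) _ hcomp'
      (hdψ.mdifferentiableAt_symm (mem_chart_target _ _))).trans ?_
    exact (congrArg _ (tangentMap_chartAt_symm_self (1 : G) X)).trans
      (tangentMap_comp_at (I' := 𝓡 n) _ hφ1 mdifferentiableAt_mul_left)
  have h2 : tangentMap (𝓡 n) (𝓡 n) (fun h => g * h) ⟨1, X⟩ =
      ⟨g, mulInvariantVectorField X g⟩ := by
    refine Bundle.TotalSpace.ext (mul_one g) ?_
    rfl
  rw [h2] at h1
  have h3 := congrArg (fun p : TangentBundle (𝓡 n) (EuclideanSpace ℝ (Fin n)) =>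
    (p.2 : EuclideanSpace ℝ (Fin n))) h1
  simp only [tangentMap, mfderiv_eq_fderiv] at h3
  exact h3.symm

theorem FinslerMetric.toFun_mulInvariantVectorField {F : FinslerMetric n G}
    (hF : F.IsBiInvariant) (X : GroupLieAlgebra (𝓡 n) G) (g : G) :
    F.toFun ⟨g, mulInvariantVectorField X g⟩ = F.toFun ⟨1, X⟩ := by
  rw [← (hF g ⟨1, X⟩).1]
  exact congrArg F.toFun (Bundle.TotalSpace.ext (mul_one g).symm HEq.rfl)

/-- Fixing the second argument of `localMul` gives a right translation in the chart. Differentiating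
in the second argument at the identity gives the left-invariant fields, whose length is
left-invariant. -/
theorem FinslerMetric.isBiInvariantOn_inChart {F : FinslerMetric n G} (hF : F.IsBiInvariant)
    (hφ : φ ∈ IsManifold.maximalAtlas (𝓡 n) ∞ G) :
    FinslerCoord.IsBiInvariantOn (F.inChart φ) φ.target (localMul φ)
      (chartAt (EuclideanSpace ℝ (Fin n)) (1 : G) 1)
      (F.inChart (chartAt (EuclideanSpace ℝ (Fin n)) (1 : G))
        (chartAt (EuclideanSpace ℝ (Fin n)) (1 : G) 1)) := by
  have hd := OpenPartialHomeomorph.mdifferentiable_of_mem_maximalAtlas hφ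
  have hψ := F.isFinslerOn_inChart (IsManifold.chart_mem_maximalAtlas (1 : G))
  have h1t := mem_chart_target (EuclideanSpace ℝ (Fin n)) (1 : G)
  refine ⟨F.isFinslerOn_inChart hφ, ?_, fun x hx => localMul_one hx, ?_, ?_, ?_,
    fun y u hy hu => hψ.posDef _ h1t y u hy hu, fun y hy => hψ.ne_zero h1t hy⟩
  · intro x hx
    have := (eventually_localMul_mem hx).self_of_nhds
    exact contDiffAt_localMul hφ hx this.1 this.2
  · intro x hx
    filter_upwards [eventually_localMul_mem hx] with z hz y
    set c := (chartAt (EuclideanSpace ℝ (Fin n)) (1 : G)).symm z with hc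
    have hm : DifferentiableAt ℝ (fun x' => localMul φ x' z) x :=
      (FinslerCoord.IsBiInvariantOn.hasFDerivAt_mul_left
        ((contDiffAt_localMul hφ hx hz.1 hz.2).differentiableAt (by simp))).differentiableAt
    have hmem : localMul φ x z ∈ φ.target := φ.map_source hz.2
    have h1 : tangentMap (𝓡 n) (𝓡 n) (fun x' => localMul φ x' z)
        (⟨x, y⟩ : TangentBundle (𝓡 n) (EuclideanSpace ℝ (Fin n))) =
        ⟨localMul φ x z, fderiv ℝ (fun x' => localMul φ x' z) x y⟩ := by
      simp only [tangentMap, mfderiv_eq_fderiv]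
      rfl
    have h2 := tangentMap_comp_at (f := fun x' => localMul φ x' z) (g := φ.symm)
      (⟨x, y⟩ : TangentBundle (𝓡 n) (EuclideanSpace ℝ (Fin n)))
      (hd.mdifferentiableAt_symm hmem) hm.mdifferentiableAt
    have h3 := tangentMap_comp_at (I' := 𝓡 n) (I'' := 𝓡 n) (f := φ.symm) (g := fun h => h * c)
      (⟨x, y⟩ : TangentBundle (𝓡 n) (EuclideanSpace ℝ (Fin n)))
      mdifferentiableAt_mul_right (hd.mdifferentiableAt_symm hx)
    -- The two maps agree only near x, where the translated point stays in the chart domain.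
    have h4 : tangentMap (𝓡 n) (𝓡 n) (φ.symm ∘ fun x' => localMul φ x' z)
        (⟨x, y⟩ : TangentBundle (𝓡 n) (EuclideanSpace ℝ (Fin n))) =
        tangentMap (𝓡 n) (𝓡 n) ((fun h => h * c) ∘ φ.symm) ⟨x, y⟩ := by
      refine tangentMap_congr_of_eventuallyEq ?_ _
      have hcont : ContinuousAt (fun x' => φ.symm x' * c) x := by
        have : ContinuousMul G := continuousMul_of_contMDiffMul (𝓡 n) ∞
        exact (φ.continuousAt_symm hx).mul continuousAt_const
      filter_upwards [hcont.eventually (φ.open_source.mem_nhds hz.2)] with x' hx'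
      exact φ.left_inv hx'
    have h5 := (h2.symm.trans h4).trans h3
    rw [h1] at h5
    exact (congrArg F.toFun h5).trans (hF c _).2
  · intro x hx Z
    have hg := φ.map_target hx
    have h1 := chartCoord_mulInvariantVectorField hφ hg Z
    rw [φ.right_inv hx] at h1
    have h2 : tangentMap (𝓡 n) (𝓡 n) φ
        ⟨φ.symm x, mulInvariantVectorField (I := 𝓡 n) (G := G) Z (φ.symm x)⟩ =
        ⟨x, fderiv ℝ (localMul φ x) (chartAt (EuclideanSpace ℝ (Fin n)) (1 : G) 1) Z⟩ := by
      refine Bundle.TotalSpace.ext (φ.right_inv hx) (heq_of_eq ?_)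
      exact h1
    have h3 := tangentMap_comp_at (I'' := 𝓡 n) (f := φ) (g := φ.symm)
      (⟨φ.symm x, mulInvariantVectorField (I := 𝓡 n) (G := G) Z (φ.symm x)⟩ :
        TangentBundle (𝓡 n) G)
      (hd.mdifferentiableAt_symm (φ.map_source hg)) (hd.mdifferentiableAt hg)
    have h4 : tangentMap (𝓡 n) (𝓡 n) (φ.symm ∘ φ)
        (⟨φ.symm x, mulInvariantVectorField (I := 𝓡 n) (G := G) Z (φ.symm x)⟩ :
          TangentBundle (𝓡 n) G) =
        ⟨φ.symm x, mulInvariantVectorField (I := 𝓡 n) (G := G) Z (φ.symm x)⟩ := by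
      refine (tangentMap_congr_of_eventuallyEq (g := id) ?_ _).trans ?_
      · filter_upwards [φ.open_source.mem_nhds hg] with q hq using φ.left_inv hq
      · exact congrFun tangentMap_id _
    rw [h2, h4] at h3
    exact (congrArg F.toFun h3.symm).trans ((toFun_mulInvariantVectorField hF Z _).trans
      (congrArg F.toFun (tangentMap_chartAt_symm_self (1 : G) Z)).symm)
  · intro y hy
    exact (hψ.smooth.contDiffAt hψ.isOpen h1t hy).comp y
      ((contDiffAt_const (c := chartAt (EuclideanSpace ℝ (Fin n)) (1 : G) 1)).prodMk contDiffAt_id)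

end LieGroups

/-! ### One-parameter subgroups as integral curves of left-invariant fields -/

section OneParameterSubgroups

open Filter Topology

variable {n : ℕ} {G : Type*} [TopologicalSpace G] [ChartedSpace (EuclideanSpace ℝ (Fin n)) G]
  [Group G]

theorem IsOneParameterSubgroup.apply_zero {γ : ℝ → G} (hγ : IsOneParameterSubgroup n γ) :
    γ 0 = 1 := by
  have := hγ.2 0 0
  rw [add_zero] at this
  exact left_eq_mul.1 this

theorem isMIntegralCurveOn_iff_curveVelocity {σ : ℝ → G} {J : Set ℝ} (hJ : UniqueDiffOn ℝ J)
    {X : GroupLieAlgebra (𝓡 n) G} (hσ : MDifferentiableOn 𝓘(ℝ, ℝ) (𝓡 n) σ J) :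
    IsMIntegralCurveOn (I := 𝓡 n) σ (mulInvariantVectorField X) J ↔
      ∀ t ∈ J, curveVelocity σ J t = mulInvariantVectorField X (σ t) := by
  refine forall₂_congr fun t ht => ⟨fun h => ?_, fun h => ?_⟩
  · exact (DFunLike.congr_fun (h.mfderivWithin (hJ t ht).uniqueMDiffWithinAt) (1 : ℝ)).trans
      (one_smul ℝ (mulInvariantVectorField X (σ t) : EuclideanSpace ℝ (Fin n)))
  · refine (hσ t ht).hasMFDerivWithinAt.congr_mfderiv (ContinuousLinearMap.ext_ring ?_)
    exact h.trans (one_smul ℝ (mulInvariantVectorField X (σ t) : EuclideanSpace ℝ (Fin n))).symm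

theorem mulInvariantVectorField_apply_one (X : GroupLieAlgebra (𝓡 n) G) :
    mulInvariantVectorField X (1 : G) = X := by
  have h1 : (fun h : G => 1 * h) = id := by funext h; simp
  have h2 : mfderiv (𝓡 n) (𝓡 n) (fun h : G => 1 * h) 1 =
      mfderiv (𝓡 n) (𝓡 n) (id : G → G) 1 := by rw [h1]
  exact (DFunLike.congr_fun h2 X).trans (DFunLike.congr_fun (mfderiv_id (I := 𝓡 n)) X)

theorem IsMIntegralCurve.tangent_zero {γ : ℝ → G} {X : GroupLieAlgebra (𝓡 n) G}
    (hγ : IsMIntegralCurve (I := 𝓡 n) γ (mulInvariantVectorField X)) (h0 : γ 0 = 1) :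
    (⟨γ 0, mfderiv 𝓘(ℝ, ℝ) (𝓡 n) γ 0 (1 : ℝ)⟩ : TangentBundle (𝓡 n) G) = ⟨1, X⟩ := by
  have h1 : mfderiv 𝓘(ℝ, ℝ) (𝓡 n) γ 0 (1 : ℝ) = mulInvariantVectorField X (γ 0) :=
    (DFunLike.congr_fun (hγ 0).mfderiv (1 : ℝ)).trans
      (one_smul ℝ (mulInvariantVectorField X (γ 0) : EuclideanSpace ℝ (Fin n)))
  rw [h1, h0, mulInvariantVectorField_apply_one]

variable [LieGroup (𝓡 n) ∞ G]

theorem contMDiff_one_mulInvariantVectorField (X : GroupLieAlgebra (𝓡 n) G) :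
    ContMDiff (𝓡 n) (𝓡 n).tangent 1
      (fun g : G => (⟨g, mulInvariantVectorField X g⟩ : TangentBundle (𝓡 n) G)) := by
  have : LieGroup (𝓡 n) (minSmoothness ℝ 3) G := LieGroup.of_le (n := ∞) (by
    rw [minSmoothness_of_isRCLikeNormedField]; norm_cast)
  exact (contMDiff_mulInvariantVectorField X).of_le (by
    rw [minSmoothness_of_isRCLikeNormedField]; norm_num)

/-- Chain rule for left translation by g followed by left translation by a. -/
theorem mfderiv_mul_left_mulInvariantVectorField (a g : G) (X : GroupLieAlgebra (𝓡 n) G) :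
    mfderiv (𝓡 n) (𝓡 n) (fun h => a * h) g (mulInvariantVectorField X g) =
      mulInvariantVectorField X (a * g) := by
  have hfun : (fun h => a * h) ∘ (fun h => g * h) = fun h : G => a * g * h := by
    funext h; simp [mul_assoc]
  have h1 := tangentMap_comp_at (I' := 𝓡 n) (I'' := 𝓡 n) (f := fun h => g * h)
    (g := fun h => a * h) (⟨1, X⟩ : TangentBundle (𝓡 n) G) mdifferentiableAt_mul_left
    mdifferentiableAt_mul_left
  rw [hfun] at h1
  have h2 : ∀ b : G, tangentMap (𝓡 n) (𝓡 n) (fun h => b * h) ⟨1, X⟩ =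
      ⟨b, mulInvariantVectorField X b⟩ := fun b =>
    Bundle.TotalSpace.ext (mul_one b) HEq.rfl
  rw [h2, h2] at h1
  exact (eq_of_heq (Bundle.TotalSpace.mk.inj h1).2).symm

theorem IsMIntegralCurveOn.const_mul {γ : ℝ → G} {X : GroupLieAlgebra (𝓡 n) G} {J : Set ℝ}
    (hγ : IsMIntegralCurveOn (I := 𝓡 n) γ (mulInvariantVectorField X) J) (a : G) :
    IsMIntegralCurveOn (I := 𝓡 n) (fun t => a * γ t) (mulInvariantVectorField X) J := by
  intro t ht
  have h1 : HasMFDerivAt (𝓡 n) (𝓡 n) (fun h => a * h) (γ t) _ :=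
    (mdifferentiableAt_mul_left (I := 𝓡 n)).hasMFDerivAt
  have h2 := h1.comp_hasMFDerivWithinAt t (hγ t ht)
  rw [← mfderiv_mul_left_mulInvariantVectorField a (γ t) X]
  refine h2.congr_mfderiv (ContinuousLinearMap.ext_ring ?_)
  exact (congrArg (mfderiv (𝓡 n) (𝓡 n) (fun h => a * h) (γ t)) (one_smul ℝ
    (mulInvariantVectorField X (γ t) : EuclideanSpace ℝ (Fin n)))).trans
    (one_smul ℝ (mfderiv (𝓡 n) (𝓡 n) (fun h => a * h) (γ t)
      (mulInvariantVectorField X (γ t)) : EuclideanSpace ℝ (Fin n))).symm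

theorem IsMIntegralCurve.const_mul {γ : ℝ → G} {X : GroupLieAlgebra (𝓡 n) G}
    (hγ : IsMIntegralCurve (I := 𝓡 n) γ (mulInvariantVectorField X)) (a : G) :
    IsMIntegralCurve (I := 𝓡 n) (fun t => a * γ t) (mulInvariantVectorField X) := by
  rw [isMIntegralCurve_iff_isMIntegralCurveOn] at hγ ⊢
  exact hγ.const_mul a

theorem contDiffAt_fderiv_localMul {φ : OpenPartialHomeomorph G (EuclideanSpace ℝ (Fin n))}
    (hφ : φ ∈ IsManifold.maximalAtlas (𝓡 n) ∞ G) {x : EuclideanSpace ℝ (Fin n)}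
    (hx : x ∈ φ.target) : ContDiffAt ℝ ∞ (fun x' => fderiv ℝ (localMul φ x')
      (chartAt (EuclideanSpace ℝ (Fin n)) (1 : G) 1)) x :=
  have h := (eventually_localMul_mem hx).self_of_nhds
  ContDiffAt.fderiv (f := localMul φ) (n := ∞) (contDiffAt_localMul hφ hx h.1 h.2)
    contDiffAt_const (by simp)

/-- Bootstrapping: in a chart the curve solves c' = V(c) with V smooth, so a Cᵏ solution is Cᵏ⁺¹. -/
theorem IsMIntegralCurve.contMDiff_of_mulInvariantVectorField {γ : ℝ → G}
    {X : GroupLieAlgebra (𝓡 n) G}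
    (hγ : IsMIntegralCurve (I := 𝓡 n) γ (mulInvariantVectorField X)) :
    ContMDiff 𝓘(ℝ, ℝ) (𝓡 n) ∞ γ := by
  intro t₀
  set φ := chartAt (EuclideanSpace ℝ (Fin n)) (γ t₀) with hφdef
  have hφ : φ ∈ IsManifold.maximalAtlas (𝓡 n) ∞ G := IsManifold.chart_mem_maximalAtlas _
  set O : Set ℝ := γ ⁻¹' φ.source with hO
  have hOo : IsOpen O := φ.open_source.preimage hγ.continuous
  have ht₀ : t₀ ∈ O := mem_chart_source _ _
  set V : EuclideanSpace ℝ (Fin n) → EuclideanSpace ℝ (Fin n) := fun x =>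
    fderiv ℝ (localMul φ x) (chartAt (EuclideanSpace ℝ (Fin n)) (1 : G) 1)
      (X : EuclideanSpace ℝ (Fin n)) with hV
  have hder : ∀ t ∈ O, HasDerivAt (fun s => φ (γ s)) (V (φ (γ t))) t := by
    intro t ht
    have h1 := chartCoord_hasDerivWithinAt hφ (J := Set.univ) ht (hγ t).hasMFDerivWithinAt
    rw [chartCoord_mulInvariantVectorField hφ ht] at h1
    exact h1.hasDerivAt Filter.univ_mem
  have hVs : ContDiffOn ℝ ∞ V φ.target := fun x hx =>
    ((contDiffAt_fderiv_localMul hφ hx).clm_apply contDiffAt_const).contDiffWithinAt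
  have hk : ∀ k : ℕ, ContDiffOn ℝ k (fun s => φ (γ s)) O := by
    intro k
    induction k with
    | zero =>
      exact contDiffOn_zero.2 fun t ht => (hder t ht).continuousAt.continuousWithinAt
    | succ k ih =>
      rw [Nat.cast_succ, contDiffOn_succ_iff_deriv_of_isOpen hOo]
      refine ⟨fun t ht => (hder t ht).differentiableAt.differentiableWithinAt,
        fun h => absurd h (by simp), ?_⟩
      exact ((hVs.of_le (by exact_mod_cast le_top)).comp ih fun t ht => φ.map_source ht).congr
        fun t ht => (hder t ht).deriv
  have hc : ContDiffOn ℝ ∞ (fun s => φ (γ s)) O := contDiffOn_infty.2 hk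
  have h1 : ContMDiffAt 𝓘(ℝ, ℝ) (𝓡 n) ∞ (fun s => φ.symm (φ (γ s))) t₀ :=
    ContMDiffAt.comp t₀ (f := fun s => φ (γ s))
      ((contMDiffOn_symm_of_mem_maximalAtlas hφ).contMDiffAt
      (φ.open_target.mem_nhds (φ.map_source ht₀)))
      (hc.contDiffAt (hOo.mem_nhds ht₀)).contMDiffAt
  refine h1.congr_of_eventuallyEq ?_
  filter_upwards [hOo.mem_nhds ht₀] with s hs using (φ.left_inv hs).symm

/-- Left-invariant fields are complete: translating one local solution through the identity gives a
solution through every point with the same lifetime ε. -/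
theorem exists_isMIntegralCurve_mulInvariantVectorField [T2Space G] (X : GroupLieAlgebra (𝓡 n) G) :
    ∃ γ : ℝ → G, γ 0 = 1 ∧ IsMIntegralCurve (I := 𝓡 n) γ (mulInvariantVectorField X) := by
  have hX := contMDiff_one_mulInvariantVectorField X
  obtain ⟨γ, h0, hγ⟩ := exists_isMIntegralCurveAt_of_contMDiffAt_boundaryless (t₀ := 0)
    (hX.contMDiffAt (x := 1))
  obtain ⟨ε, hε, hγ⟩ := isMIntegralCurveAt_iff'.1 hγ
  rw [Real.ball_eq_Ioo, zero_sub, zero_add] at hγ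
  exact exists_isMIntegralCurve_of_isMIntegralCurveOn hX hε
    (fun a => ⟨fun t => a * γ t, by simp [h0], hγ.const_mul a⟩) 1

/-- Both t ↦ γ(t + s) and t ↦ γ(s) γ(t) are integral curves starting at γ(s), so uniqueness
identifies them. -/
theorem IsMIntegralCurve.isOneParameterSubgroup [T2Space G] {γ : ℝ → G}
    {X : GroupLieAlgebra (𝓡 n) G}
    (hγ : IsMIntegralCurve (I := 𝓡 n) γ (mulInvariantVectorField X)) (h0 : γ 0 = 1) :
    IsOneParameterSubgroup n γ := by
  refine ⟨hγ.contMDiff_of_mulInvariantVectorField, fun s t => ?_⟩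
  have := isMIntegralCurve_Ioo_eq_of_contMDiff_boundaryless (t₀ := 0)
    (contMDiff_one_mulInvariantVectorField X) (hγ.comp_add s) (hγ.const_mul (γ s)) (by simp [h0])
  rw [add_comm]
  exact congrFun this t

/-- Differentiate γ(s) = γ(t) γ(s - t) in s at s = t. -/
theorem IsOneParameterSubgroup.isMIntegralCurve {γ : ℝ → G} (hγ : IsOneParameterSubgroup n γ)
    {X : GroupLieAlgebra (𝓡 n) G} (hX : (⟨γ 0, mfderiv 𝓘(ℝ, ℝ) (𝓡 n) γ 0 (1 : ℝ)⟩ :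
      TangentBundle (𝓡 n) G) = ⟨1, X⟩) :
    IsMIntegralCurve (I := 𝓡 n) γ (mulInvariantVectorField X) := by
  intro t
  have hX' : (mfderiv 𝓘(ℝ, ℝ) (𝓡 n) γ 0 (1 : ℝ) : EuclideanSpace ℝ (Fin n)) = X :=
    eq_of_heq (Bundle.TotalSpace.mk.inj hX).2
  -- Formulated for any s equal to 0 because the chain rule evaluates it at t - t.
  have h0 : ∀ s : ℝ, s = 0 → HasMFDerivAt 𝓘(ℝ, ℝ) (𝓡 n) γ s
      ((1 : ℝ →L[ℝ] ℝ).smulRight (X : EuclideanSpace ℝ (Fin n))) := by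
    rintro s rfl
    refine (hγ.1.mdifferentiableAt (by simp)).hasMFDerivAt.congr_mfderiv ?_
    refine ContinuousLinearMap.ext_ring ?_
    exact hX'.trans (one_smul ℝ (X : EuclideanSpace ℝ (Fin n))).symm
  have hsub : HasMFDerivAt 𝓘(ℝ, ℝ) 𝓘(ℝ, ℝ) (fun s : ℝ => s - t) t
      (ContinuousLinearMap.id ℝ ℝ) :=
    ((hasFDerivAt_id t).sub_const t).hasMFDerivAt
  have h1 := HasMFDerivAt.comp (f := fun s : ℝ => s - t) t (h0 (t - t) (sub_self t)) hsub
  have hmul : ∀ g : G, g = 1 → HasMFDerivAt (𝓡 n) (𝓡 n) (fun h => γ t * h) g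
      (mfderiv (𝓡 n) (𝓡 n) (fun h => γ t * h) (1 : G)) := by
    rintro g rfl
    exact mdifferentiableAt_mul_left.hasMFDerivAt
  have h2 := (hmul (γ (t - t)) (by rw [sub_self, hγ.apply_zero])).comp t h1
  have hfun : (fun h => γ t * h) ∘ γ ∘ (fun s : ℝ => s - t) = γ := by
    funext s
    simp [← hγ.2]
  rw [hfun] at h2
  refine h2.congr_mfderiv ?_
  refine ContinuousLinearMap.ext_ring ?_
  have h3 : mulInvariantVectorField X (γ t) =
    mfderiv (𝓡 n) (𝓡 n) (fun h => γ t * h) (1 : G) X := rfl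
  have h4 : ((1 : ℝ →L[ℝ] ℝ).smulRight (X : EuclideanSpace ℝ (Fin n))) (1 : ℝ) = X :=
    one_smul ℝ (X : EuclideanSpace ℝ (Fin n))
  exact (congrArg (mfderiv (𝓡 n) (𝓡 n) (fun h => γ t * h) (1 : G)) h4).trans
    (one_smul ℝ (mulInvariantVectorField X (γ t) : EuclideanSpace ℝ (Fin n))).symm

theorem IsOneParameterSubgroup.exists_isMIntegralCurve {γ : ℝ → G}
    (hγ : IsOneParameterSubgroup n γ) : ∃ X : GroupLieAlgebra (𝓡 n) G,
      IsMIntegralCurve (I := 𝓡 n) γ (mulInvariantVectorField X) :=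
  ⟨(mfderiv 𝓘(ℝ, ℝ) (𝓡 n) γ 0 (1 : ℝ) : EuclideanSpace ℝ (Fin n)),
    hγ.isMIntegralCurve (Bundle.TotalSpace.ext hγ.apply_zero HEq.rfl)⟩

/-- Uniqueness of integral curves makes the choice inside `lieExp` immaterial, and s ↦ γ(s t) is the
integral curve of the field of t X. -/
theorem lieExp_smul [T2Space G] {γ : ℝ → G} {X : GroupLieAlgebra (𝓡 n) G}
    (hγ : IsMIntegralCurve (I := 𝓡 n) γ (mulInvariantVectorField X)) (h0 : γ 0 = 1) (t : ℝ) :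
    lieExp (t • X) = γ t := by
  obtain ⟨δ, hδ0, hδ⟩ := exists_isMIntegralCurve_mulInvariantVectorField (t • X)
  have hex : ∃ δ : ℝ → G, IsOneParameterSubgroup n δ ∧
      (⟨δ 0, mfderiv 𝓘(ℝ, ℝ) (𝓡 n) δ 0 (1 : ℝ)⟩ : TangentBundle (𝓡 n) G) = ⟨1, t • X⟩ :=
    ⟨δ, hδ.isOneParameterSubgroup hδ0, hδ.tangent_zero hδ0⟩
  rw [lieExp, dif_pos hex]
  have h1 := hex.choose_spec.1.isMIntegralCurve hex.choose_spec.2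
  have h2 := hγ.comp_mul t
  rw [← mulInvariantVectorField_smul] at h2
  have h3 := isMIntegralCurve_Ioo_eq_of_contMDiff_boundaryless (t₀ := 0)
    (contMDiff_one_mulInvariantVectorField (t • X)) h1 h2
    (by simp [h0, hex.choose_spec.1.apply_zero])
  simpa using congrFun h3 1

/-- A one-parameter subgroup is nontrivial exactly when its generator is nonzero. -/
theorem IsMIntegralCurve.exists_ne_one_iff [T2Space G] {γ : ℝ → G} {X : GroupLieAlgebra (𝓡 n) G}
    (hγ : IsMIntegralCurve (I := 𝓡 n) γ (mulInvariantVectorField X)) (h0 : γ 0 = 1) :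
    (∃ t, γ t ≠ 1) ↔ X ≠ 0 := by
  constructor
  · rintro ⟨t, ht⟩ rfl
    refine ht ?_
    -- For the zero generator, γ(t) = exp(t 0) = exp(0 0) = γ(0).
    rw [← lieExp_smul hγ h0, smul_zero, ← zero_smul ℝ (0 : GroupLieAlgebra (𝓡 n) G),
      lieExp_smul hγ h0, h0]
  · intro hX
    by_contra! hconst
    refine hX ?_
    obtain rfl : γ = fun _ => 1 := funext hconst
    have h1 := hγ.tangent_zero rfl
    rw [mfderiv_const] at h1
    exact (eq_of_heq (Bundle.TotalSpace.mk.inj h1).2).symm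

/-- An integral curve of a left-invariant field on an interval is a translate of a one-parameter
subgroup. -/
theorem IsMIntegralCurveOn.exists_eq_mul [T2Space G] {σ γ : ℝ → G}
    {X : GroupLieAlgebra (𝓡 n) G} {J : Set ℝ}
    (hJ : J.OrdConnected) (hJn : J.Nontrivial)
    (hσ : IsMIntegralCurveOn (I := 𝓡 n) σ (mulInvariantVectorField X) J)
    (hγ : IsMIntegralCurve (I := 𝓡 n) γ (mulInvariantVectorField X)) :
    ∃ a : G, ∀ t ∈ J, σ t = a * γ t := by
  obtain ⟨x, hx, y, hy, hxy⟩ := hJn.exists_lt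
  -- Uniqueness is applied on an open interval around the interior time t₁. Continuity then extends
  -- the equality to the closed interval, as t may be an end point of J.
  obtain ⟨t₁, hxt, hty⟩ := exists_between hxy
  refine ⟨σ t₁ * (γ t₁)⁻¹, fun t ht => ?_⟩
  set a := σ t₁ * (γ t₁)⁻¹ with ha
  have hmin : min x t ∈ J := by rcases min_choice x t with h | h <;> rw [h] <;> assumption
  have hmax : max y t ∈ J := by rcases max_choice y t with h | h <;> rw [h] <;> assumption
  have hsub : Set.Icc (min x t) (max y t) ⊆ J := hJ.out hmin hmax
  have hmem : t₁ ∈ Set.Ioo (min x t) (max y t) :=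
    ⟨(min_le_left _ _).trans_lt hxt, hty.trans_le (le_max_left _ _)⟩
  have hγa := (hγ.const_mul a).isMIntegralCurveOn (Set.Icc (min x t) (max y t))
  have heq := isMIntegralCurveOn_Ioo_eqOn_of_contMDiff_boundaryless hmem
    (contMDiff_one_mulInvariantVectorField X) (hσ.mono (Set.Ioo_subset_Icc_self.trans hsub))
    (hγa.mono Set.Ioo_subset_Icc_self) (by simp [ha])
  refine heq.of_subset_closure (hσ.mono hsub).continuousOn hγa.continuousOn
    Set.Ioo_subset_Icc_self ?_ ⟨min_le_right _ _, le_max_right _ _⟩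
  rw [closure_Ioo (hmem.1.trans hmem.2).ne]

/-- The curves whose velocity is left-invariant are the translates of the nontrivial one-parameter
subgroups. -/
theorem exists_curveVelocity_eq_iff [T2Space G] {σ : ℝ → G} {J : Set ℝ} (hJ : J.OrdConnected)
    (hJn : J.Nontrivial) (hJu : UniqueDiffOn ℝ J) :
    (ContMDiffOn 𝓘(ℝ, ℝ) (𝓡 n) ∞ σ J ∧ ∃ X : GroupLieAlgebra (𝓡 n) G, X ≠ 0 ∧
      ∀ t ∈ J, curveVelocity σ J t = mulInvariantVectorField X (σ t)) ↔
    ∃ (a : G) (γ : ℝ → G), IsOneParameterSubgroup n γ ∧ (∃ t, γ t ≠ 1) ∧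
      ∀ t ∈ J, σ t = a * γ t := by
  constructor
  · rintro ⟨hσ, X, hX, hv⟩
    obtain ⟨γ, h0, hγ⟩ := exists_isMIntegralCurve_mulInvariantVectorField X
    obtain ⟨a, ha⟩ := ((isMIntegralCurveOn_iff_curveVelocity hJu
      (hσ.mdifferentiableOn (by simp))).2 hv).exists_eq_mul hJ hJn hγ
    exact ⟨a, γ, hγ.isOneParameterSubgroup h0, (hγ.exists_ne_one_iff h0).2 hX, ha⟩
  · rintro ⟨a, γ, hγ, hne, hσ⟩
    obtain ⟨X, hX⟩ := hγ.exists_isMIntegralCurve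
    have hs : ContMDiffOn 𝓘(ℝ, ℝ) (𝓡 n) ∞ σ J :=
      ((contMDiff_mul_left (I := 𝓡 n) (a := a)).comp hγ.1).contMDiffOn.congr hσ
    refine ⟨hs, X, (hX.exists_ne_one_iff hγ.apply_zero).1 hne, ?_⟩
    rw [← isMIntegralCurveOn_iff_curveVelocity hJu (hs.mdifferentiableOn (by simp))]
    intro t ht
    have h1 := ((hX.const_mul a).isMIntegralCurveOn J t ht).congr_of_eventuallyEq
      (eventually_of_mem self_mem_nhdsWithin hσ) (hσ t ht)
    rwa [← hσ t ht] at h1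

end OneParameterSubgroups

/-! ### Geodesics of bi-invariant metrics -/

section Geodesics

open Filter Topology

variable {n : ℕ} {G : Type*} [TopologicalSpace G] [ChartedSpace (EuclideanSpace ℝ (Fin n)) G]

theorem hasMFDerivWithinAt_curveVelocity {σ : ℝ → G} {J : Set ℝ} {t : ℝ}
    (hσ : MDifferentiableWithinAt 𝓘(ℝ, ℝ) (𝓡 n) σ J t) :
    HasMFDerivWithinAt 𝓘(ℝ, ℝ) (𝓡 n) σ J t
      ((1 : ℝ →L[ℝ] ℝ).smulRight (curveVelocity (n := n) σ J t)) := by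
  refine hσ.hasMFDerivWithinAt.congr_mfderiv (ContinuousLinearMap.ext_ring ?_)
  exact (one_smul ℝ (curveVelocity (n := n) σ J t : EuclideanSpace ℝ (Fin n))).symm

theorem chartCoord_injective {φ : OpenPartialHomeomorph G (EuclideanSpace ℝ (Fin n))}
    (hφ : φ ∈ IsManifold.maximalAtlas (𝓡 n) ∞ G) {g : G} (hg : g ∈ φ.source) :
    Function.Injective (chartCoord φ g) :=
  (OpenPartialHomeomorph.mdifferentiable_of_mem_maximalAtlas hφ).mfderiv_injective hg

/-- For a curve of constant speed, the geodesic equation does not see the normalization of the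
velocity. -/
theorem FinslerMetric.covDerivAlong_of_const_speed [IsManifold (𝓡 n) ∞ G] (F : FinslerMetric n G)
    {σ : ℝ → G} {J : Set ℝ} {t : ℝ} (ht : t ∈ J) (hJ : UniqueDiffWithinAt ℝ J t) {K : ℝ}
    (hK : ∀ s ∈ J, F.toFun ⟨σ s, curveVelocity (n := n) σ J s⟩ = K)
    {φ : OpenPartialHomeomorph G (EuclideanSpace ℝ (Fin n))} {w : EuclideanSpace ℝ (Fin n)}
    (hw : HasDerivWithinAt (fun s => chartCoord φ (σ s) (curveVelocity (n := n) σ J s)) w J t)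
    (i : Fin n) :
    F.covDerivAlong φ σ J
      (fun s => (F.toFun ⟨σ s, curveVelocity σ J s⟩)⁻¹ • curveVelocity σ J s)
      (fun s => curveVelocity σ J s) t i =
    K⁻¹ * (w i + ∑ j, ∑ k, chartCoord φ (σ t) (curveVelocity σ J t) j *
      chartCoord φ (σ t) (curveVelocity σ J t) k *
      FinslerCoord.chernChristoffel (F.inChart φ) i j k (φ (σ t))
        (chartCoord φ (σ t) (curveVelocity σ J t))) := by
  have h1 : ∀ s ∈ J, ∀ j, chartCoord φ (σ s)
      ((F.toFun ⟨σ s, curveVelocity σ J s⟩)⁻¹ • curveVelocity σ J s) j =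
      K⁻¹ * chartCoord φ (σ s) (curveVelocity σ J s) j := by
    intro s hs j
    rw [hK s hs]
    exact congrArg (fun v : EuclideanSpace ℝ (Fin n) => v j)
      (map_smul (mfderiv (𝓡 n) (𝓡 n) φ (σ s)) K⁻¹ (curveVelocity σ J s))
  have h2 : HasDerivWithinAt (fun s => chartCoord φ (σ s) (curveVelocity (n := n) σ J s) i)
      (w i) J t :=
    (EuclideanSpace.proj i : EuclideanSpace ℝ (Fin n) →L[ℝ] ℝ).hasFDerivAt.comp_hasDerivWithinAt
      t hw
  have h3 := ((h2.const_mul K⁻¹).congr (fun s hs => h1 s hs i) (h1 t ht i)).derivWithin hJ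
  rw [covDerivAlong, h3]
  simp only [h1 t ht, mul_add, Finset.mul_sum]
  congr 1
  exact Finset.sum_congr rfl fun j _ => Finset.sum_congr rfl fun k _ => by ring

variable [Group G] [LieGroup (𝓡 n) ∞ G]

/-- The left-invariant frame is bijective in a chart, and chart coordinates are injective on the
fibre. -/
theorem FinslerMetric.exists_mulInvariantVectorField_eq {F : FinslerMetric n G}
    (hF : F.IsBiInvariant) (g : G) (w : TangentSpace (𝓡 n) g) :
    ∃ X : GroupLieAlgebra (𝓡 n) G, w = mulInvariantVectorField X g := by
  have hφ := IsManifold.chart_mem_maximalAtlas (I := 𝓡 n) (n := ∞) g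
  have hg := mem_chart_source (EuclideanSpace ℝ (Fin n)) g
  obtain ⟨e, he⟩ := (isBiInvariantOn_inChart hF hφ).exists_frame_equiv (mem_chart_target _ g)
  obtain ⟨X, hX⟩ := e.surjective (chartCoord (chartAt _ g) g w)
  exact ⟨X, chartCoord_injective hφ hg (hX.symm.trans
    ((DFunLike.congr_fun he X).trans (chartCoord_mulInvariantVectorField hφ hg X).symm))⟩

/-- A constant speed curve satisfies the geodesic equation exactly when the left trivialization of
its velocity is stationary. -/
theorem FinslerMetric.covDerivAlong_eq_zero_iff {F : FinslerMetric n G}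
    (hF : F.IsBiInvariant) {σ : ℝ → G} {J : Set ℝ} (hJ : UniqueDiffOn ℝ J)
    (hσ : ContMDiffOn 𝓘(ℝ, ℝ) (𝓡 n) ∞ σ J) {ξ : ℝ → EuclideanSpace ℝ (Fin n)}
    (hξ : ∀ s ∈ J, curveVelocity σ J s = mulInvariantVectorField (I := 𝓡 n) (ξ s) (σ s)) {K : ℝ}
    (hK : ∀ s ∈ J, F.toFun ⟨σ s, curveVelocity (n := n) σ J s⟩ = K) {t : ℝ} (ht : t ∈ J)
    (hne : curveVelocity (n := n) σ J t ≠ 0)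
    {φ : OpenPartialHomeomorph G (EuclideanSpace ℝ (Fin n))}
    (hφ : φ ∈ IsManifold.maximalAtlas (𝓡 n) ∞ G) (hσt : σ t ∈ φ.source) :
    DifferentiableWithinAt ℝ ξ J t ∧
    ((∀ i, F.covDerivAlong φ σ J
      (fun s => (F.toFun ⟨σ s, curveVelocity σ J s⟩)⁻¹ • curveVelocity σ J s)
      (fun s => curveVelocity σ J s) t i = 0) ↔
      derivWithin ξ J t = 0) := by
  have hm := isBiInvariantOn_inChart hF hφ
  set c : ℝ → EuclideanSpace ℝ (Fin n) := fun s => φ (σ s) with hc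
  set v : ℝ → EuclideanSpace ℝ (Fin n) := fun s =>
    chartCoord φ (σ s) (curveVelocity (n := n) σ J s) with hv
  have hder : ∀ s ∈ J, σ s ∈ φ.source → HasDerivWithinAt c (v s) J s := fun s hs hsφ =>
    chartCoord_hasDerivWithinAt hφ hsφ
      (hasMFDerivWithinAt_curveVelocity (hσ.mdifferentiableOn (by simp) s hs))
  have hev : ∀ᶠ s in 𝓝[J] t, s ∈ J ∧ σ s ∈ φ.source :=
    Filter.Eventually.and self_mem_nhdsWithin
      ((hσ t ht).continuousWithinAt.eventually (φ.open_source.mem_nhds hσt))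
  have hcs : ContDiffWithinAt ℝ ∞ c J t :=
    (((contMDiffOn_of_mem_maximalAtlas hφ).contMDiffAt
      (φ.open_source.mem_nhds hσt)).comp_contMDiffWithinAt t (hσ t ht)).contDiffWithinAt
  -- The velocity coordinates are known to be the derivative of `c` only while the curve stays in
  -- the chart, hence the localization by `hev`.
  have hvd : DifferentiableWithinAt ℝ v J t := by
    have h1 : DifferentiableWithinAt ℝ (fun s => fderivWithin ℝ c J s 1) J t :=
      ((hcs.fderivWithin_right (m := 1) hJ (by norm_cast) ht).differentiableWithinAt
        (by simp)).clm_apply (differentiableWithinAt_const _)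
    have h2 : ∀ s, s ∈ J ∧ σ s ∈ φ.source → v s = fderivWithin ℝ c J s 1 := fun s hs =>
      ((hder s hs.1 hs.2).derivWithin (hJ s hs.1)).symm
    exact h1.congr_of_eventuallyEq (hev.mono h2) (h2 t ⟨ht, hσt⟩)
  have hvξ : ∀ᶠ s in 𝓝[J] t, v s = fderiv ℝ (localMul φ (c s))
      (chartAt (EuclideanSpace ℝ (Fin n)) (1 : G) 1) (ξ s) := by
    filter_upwards [hev] with s hs
    exact (congrArg (chartCoord φ (σ s)) (hξ s hs.1)).trans
      (chartCoord_mulInvariantVectorField hφ hs.2 (ξ s))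
  have hv0 : v t ≠ 0 := fun h => hne (chartCoord_injective hφ hσt
    (h.trans (map_zero (mfderiv (𝓡 n) (𝓡 n) φ (σ t))).symm))
  have hU : c t ∈ φ.target := φ.map_source hσt
  have hct := hder t ht hσt
  have hK0 : K ≠ 0 := by
    rw [← hK t ht]; exact F.toFun_ne_zero _ hne
  refine ⟨hm.differentiableWithinAt_of_frame ht hU hct.differentiableWithinAt hvd hvξ, ?_⟩
  rw [← hm.geodesic_iff_derivWithin_eq_zero (hJ t ht) ht hU hv0 hct hvd.hasDerivWithinAt hvξ]
  refine forall_congr' fun i => ?_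
  rw [F.covDerivAlong_of_const_speed ht (hJ t ht) hK hvd.hasDerivWithinAt i, mul_eq_zero,
    or_iff_right (inv_ne_zero hK0)]

/-- The constant speed geodesics of a bi-invariant Finsler metric are the curves with left-invariant
velocity. -/
theorem FinslerMetric.isConstSpeedGeodesicOn_iff_curveVelocity {F : FinslerMetric n G}
    (hF : F.IsBiInvariant) {σ : ℝ → G} {J : Set ℝ} (hJ : J.OrdConnected) (hJn : J.Nontrivial)
    (hJu : UniqueDiffOn ℝ J) :
    F.IsConstSpeedGeodesicOn σ J ↔
      ContMDiffOn 𝓘(ℝ, ℝ) (𝓡 n) ∞ σ J ∧ ∃ X : GroupLieAlgebra (𝓡 n) G, X ≠ 0 ∧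
        ∀ t ∈ J, curveVelocity σ J t = mulInvariantVectorField X (σ t) := by
  constructor
  · rintro ⟨⟨hσ, hne, hcov⟩, hspeed⟩
    -- ξ is chosen pointwise with no regularity; its differentiability is part of
    -- `covDerivAlong_eq_zero_iff`.
    obtain ⟨ξ, hξ⟩ : ∃ ξ : ℝ → EuclideanSpace ℝ (Fin n), ∀ s,
        curveVelocity σ J s = mulInvariantVectorField (I := 𝓡 n) (ξ s) (σ s) :=
      Classical.axiomOfChoice fun s =>
        exists_mulInvariantVectorField_eq hF (σ s) (curveVelocity σ J s)
    obtain ⟨t₀, ht₀⟩ := hJn.nonempty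
    have key := fun t (ht : t ∈ J) => covDerivAlong_eq_zero_iff hF hJu hσ (fun s _ => hξ s)
      (fun s hs => hspeed s hs t₀ ht₀) ht (hne t ht)
      (IsManifold.chart_mem_maximalAtlas (I := 𝓡 n) (n := ∞) (σ t)) (mem_chart_source _ (σ t))
    have hconst : ∀ t ∈ J, ξ t = ξ t₀ := fun t ht =>
      hJ.convex.is_const_of_fderivWithin_eq_zero (𝕜 := ℝ)
        (fun s hs => (key s hs).1)
        (fun s hs => ContinuousLinearMap.ext_ring ((key s hs).2.1 (hcov _
          (IsManifold.chart_mem_maximalAtlas _) s hs (mem_chart_source _ _)))) ht ht₀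
    refine ⟨hσ, ξ t₀, fun h0 => hne t₀ ht₀ ?_, fun t ht => by rw [hξ t, hconst t ht]⟩
    rw [hξ t₀, h0]
    exact map_zero (mfderiv (𝓡 n) (𝓡 n) (fun h => σ t₀ * h) (1 : G))
  · rintro ⟨hσ, X, hX, hv⟩
    have hK : ∀ s ∈ J, F.toFun ⟨σ s, curveVelocity (n := n) σ J s⟩ = F.toFun ⟨1, X⟩ := by
      intro s hs
      rw [hv s hs, toFun_mulInvariantVectorField hF]
    have hne : ∀ t ∈ J, curveVelocity (n := n) σ J t ≠ 0 := by
      intro t ht h0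
      have h1 := hK t ht
      rw [h0, ← zero_smul ℝ (0 : TangentSpace (𝓡 n) (σ t)), F.homogeneous _ _ _ le_rfl,
        zero_mul] at h1
      exact F.toFun_ne_zero 1 hX h1.symm
    refine ⟨⟨hσ, hne, fun φ hφ t ht hσt => ?_⟩, fun s hs t ht => by rw [hK s hs, hK t ht]⟩
    have hconst : ∀ Y : EuclideanSpace ℝ (Fin n), derivWithin (fun _ : ℝ => Y) J t = 0 :=
      fun Y => congrFun (derivWithin_const J Y) t
    exact (covDerivAlong_eq_zero_iff (ξ := fun _ => X) hF hJu hσ hv hK ht (hne t ht) hφ hσt).2.2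
      (hconst X)

theorem FinslerMetric.isConstSpeedGeodesicOn_iff_left [T2Space G] {F : FinslerMetric n G}
    (hF : F.IsBiInvariant) {σ : ℝ → G} {J : Set ℝ} (hJ : J.OrdConnected) (hJn : J.Nontrivial) :
    F.IsConstSpeedGeodesicOn σ J ↔
      ∃ (a : G) (γ : ℝ → G), IsOneParameterSubgroup n γ ∧ (∃ t, γ t ≠ 1) ∧
        ∀ t ∈ J, σ t = a * γ t := by
  -- An interval with two points contains an open interval, and a convex set with nonempty interior
  -- has unique derivatives.
  have hJu : UniqueDiffOn ℝ J := uniqueDiffOn_convex hJ.convex (by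
    obtain ⟨x, hx, y, hy, hxy⟩ := hJn.exists_lt
    obtain ⟨t, ht⟩ := Set.nonempty_Ioo.2 hxy
    exact ⟨t, mem_interior.2 ⟨_, Set.Ioo_subset_Icc_self.trans (hJ.out hx hy), isOpen_Ioo, ht⟩⟩)
  rw [isConstSpeedGeodesicOn_iff_curveVelocity hF hJ hJn hJu,
    exists_curveVelocity_eq_iff hJ hJn hJu]

theorem IsOneParameterSubgroup.conj {γ : ℝ → G} (hγ : IsOneParameterSubgroup n γ) (a : G) :
    IsOneParameterSubgroup n (fun t => a * γ t * a⁻¹) :=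
  ⟨(contMDiff_mul_right (I := 𝓡 n) (a := a⁻¹)).comp
    ((contMDiff_mul_left (I := 𝓡 n) (a := a)).comp hγ.1), fun s t => by
      simp [hγ.2, mul_assoc]⟩

/-- From a γ = (a γ a⁻¹) a, with a conjugate of a nontrivial one-parameter subgroup again
nontrivial. -/
theorem exists_left_coset_iff_exists_right_coset {σ : ℝ → G} {J : Set ℝ} :
    (∃ (a : G) (γ : ℝ → G), IsOneParameterSubgroup n γ ∧ (∃ t, γ t ≠ 1) ∧
      ∀ t ∈ J, σ t = a * γ t) ↔
    ∃ (a : G) (γ : ℝ → G), IsOneParameterSubgroup n γ ∧ (∃ t, γ t ≠ 1) ∧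
      ∀ t ∈ J, σ t = γ t * a := by
  constructor
  · rintro ⟨a, γ, hγ, ⟨t, ht⟩, h⟩
    exact ⟨a, _, hγ.conj a, ⟨t, by simpa [mul_inv_eq_one] using ht⟩,
      fun s hs => by simp [h s hs]⟩
  · rintro ⟨a, γ, hγ, ⟨t, ht⟩, h⟩
    exact ⟨a, _, hγ.conj a⁻¹, ⟨t, by simpa using (conj_eq_one_iff (a := a⁻¹)).not.2 ht⟩,
      fun s hs => by simp [h s hs, mul_assoc]⟩

theorem FinslerMetric.isGeodesicVector [T2Space G] {F : FinslerMetric n G}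
    (hF : F.IsBiInvariant) {X : GroupLieAlgebra (𝓡 n) G} (hX : X ≠ 0) : F.IsGeodesicVector X := by
  obtain ⟨γ, h0, hγ⟩ := exists_isMIntegralCurve_mulInvariantVectorField X
  refine ⟨hX, (isConstSpeedGeodesicOn_iff_left hF Set.ordConnected_univ Set.nontrivial_univ).2
    ⟨1, γ, hγ.isOneParameterSubgroup h0, (hγ.exists_ne_one_iff h0).2 hX, fun t _ => ?_⟩⟩
  rw [lieExp_smul hγ h0, one_mul]

end Geodesics

theorem theorem3p4 {n : ℕ} {G : Type*} [TopologicalSpace G] [T2Space G] [ConnectedSpace G]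
    [ChartedSpace (EuclideanSpace ℝ (Fin n)) G] [Group G] [LieGroup (𝓡 n) ∞ G]
    (F : FinslerMetric n G) (hF : F.IsBiInvariant) :
    -- every nonzero vector of the Lie algebra is a geodesic vector
    (∀ X : GroupLieAlgebra (𝓡 n) G, X ≠ 0 → F.IsGeodesicVector X) ∧
    -- geodesics starting at the identity are the nontrivial one-parameter subgroups
    (∀ J : Set ℝ, J.OrdConnected → J.Nontrivial → 0 ∈ J → ∀ σ : ℝ → G, σ 0 = 1 →
      (F.IsConstSpeedGeodesicOn σ J ↔
        ∃ γ : ℝ → G, IsOneParameterSubgroup n γ ∧ (∃ t, γ t ≠ 1) ∧ ∀ t ∈ J, σ t = γ t)) ∧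
    -- all geodesics are their left cosets, and equally their right cosets
    (∀ J : Set ℝ, J.OrdConnected → J.Nontrivial → ∀ σ : ℝ → G,
      (F.IsConstSpeedGeodesicOn σ J ↔
        ∃ (a : G) (γ : ℝ → G), IsOneParameterSubgroup n γ ∧ (∃ t, γ t ≠ 1) ∧
          ∀ t ∈ J, σ t = a * γ t) ∧
      (F.IsConstSpeedGeodesicOn σ J ↔
        ∃ (a : G) (γ : ℝ → G), IsOneParameterSubgroup n γ ∧ (∃ t, γ t ≠ 1) ∧
          ∀ t ∈ J, σ t = γ t * a)) := by
  refine ⟨fun X hX => FinslerMetric.isGeodesicVector hF hX, fun J hJ hJn h0 σ hσ => ?_,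
    fun J hJ hJn σ => ⟨FinslerMetric.isConstSpeedGeodesicOn_iff_left hF hJ hJn, ?_⟩⟩
  · rw [FinslerMetric.isConstSpeedGeodesicOn_iff_left hF hJ hJn]
    constructor
    · rintro ⟨a, γ, hγ, hne, h⟩
      -- Evaluation at time 0, where both σ and γ are the identity.
      have ha : a = 1 := by simpa [hσ, hγ.apply_zero] using (h 0 h0).symm
      exact ⟨γ, hγ, hne, fun t ht => by rw [h t ht, ha, one_mul]⟩
    · rintro ⟨γ, hγ, hne, h⟩
      exact ⟨1, γ, hγ, hne, fun t ht => by rw [h t ht, one_mul]⟩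
  · rw [FinslerMetric.isConstSpeedGeodesicOn_iff_left hF hJ hJn,
      exists_left_coset_iff_exists_right_coset]
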